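/- **Setting.** For $x\in\mathbb R^3$ let $[x]_\times$ be the skew-symmetric matrix with $[x]_\times y=x\times y$, let $e_3=(0,0,1)^\top$, and for $R\in SO(3)$ let $|R|_I\in[0,1]$ be defined by $|R|_I^2=\tfrac18\|I-R\|_F^2$. A rigid body with attitude $R(t)\in SO(3)$, velocity $v(t)$, body angular velocity $\omega(t)$ and body-frame apparent acceleration $b_a(t)$ satisfies, for all $t\ge 0$, $$\dot v=ge_3+Rb_a,\qquad \dot R=R[\omega]_\times .$$ Put $r_a=Rb_a=\dot v-ge_3$. The measurements are $v$, $b_a=R^\top r_a$, $b_m=R^\top r_m$ with a known constant vector $r_m\in\mathbb R^3$, and $\omega_y=\omega+b_\omega$ with an unknown constant gyro bias $b_\omega$. There are constants $c_0,\dots,c_5>0$ such that, for all $t\ge0$, $$\frac{\|r_m\times r_a(t)\|}{\|r_m\|\,\|r_a(t)\|}\ge c_0,\quad c_1\le\|r_a(t)\|\le c_2,\quad \|\dot r_a(t)\|\le c_3,\quad \|\omega(t)\|\le c_4,\quad \|b_\omega\|\le c_5 .$$ The observer, with gains $k_v,k_R,k_b,\rho_1,\rho_2>0$, is $$\dot{\hat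 v}=ge_3+\hat Rb_a+k_v\sigma_v,\qquad \dot{\hat R}=\hat R[\omega_y-\hat b_\omega+k_R\sigma_R]_\times,\qquad \dot{\hat b}_\omega=\mathrm{Proj}(\hat b_\omega,-k_b\sigma_R),$$ $$\hat r_a=k_v(v-\hat v)+\hat Rb_a,\quad \sigma_R=\rho_1(b_m\times\hat R^\top r_m)+\rho_2(b_a\times\hat R^\top\hat r_a),\quad \sigma_v=v-\hat v+\tfrac{k_R}{k_v^2}\hat R[\sigma_R]_\times b_a,$$ with $\hat R\in SO(3)$. Here $\mathrm{Proj}:\mathbb R^3\times\mathbb R^3\to\mathbb R^3$ is any map for which (P1) solutions of $\dot{\hat b}=\mathrm{Proj}(\hat b,\mu(t))$ with $\mu$ continuous that start in the ball $\|\hat b\|\le c_5$ stay in it, and, whenever $\|\hat b\|\le c_5$ and $\mu\in\mathbb R^3$, (P2) $(\hat b-b_\omega)^\top\mathrm{Proj}(\hat b,\mu)\le(\hat b-b_\omega)^\top\mu$ and (P3) $\|\mathrm{Proj}(\hat b,\mu)\|\le\|\mu\|$. Solutions are understood in the sense of Carathéodory (absolutely continuous, satisfying the equations almost everywhere). The errors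 are $\tilde R=R\hat R^\top$, $\tilde b_\omega=b_\omega-\hat b_\omega$, $\tilde r_a=r_a-\hat r_a$; write $\|z(t)\|=\big(|\tilde R(t)|_I^2+\|\tilde b_\omega(t)\|^2+\|\tilde r_a(t)\|^2\big)^{1/2}$. **Theorem.** Fix $g$, $r_m$, $\rho_1,\rho_2,k_b>0$ and $c_0,\dots,c_5>0$. For every $0<\varepsilon_R<1$ and every $B\ge 0$ there is a threshold $\underline{k_R}>0$, and for every $k_R\ge\underline{k_R}$ there is a threshold $\underline{k_v}>0$ (which may depend on $k_R$), such that for every $k_v>\underline{k_v}$ the equilibrium $(\tilde R,\tilde b_\omega,\tilde r_a)=(I,0,0)$ is exponentially stable, with all initial errors $|\tilde R(t_0)|_I\le\varepsilon_R$, $\|\tilde r_a(t_0)\|\le B$ and all initial bias estimates $\|\hat b_\omega(t_0)\|\le c_5$ in its region of exponential convergence (semi-global exponential stability). That is, there are $C,\alpha>0$ such that for every rigid-body motion and every $\mathrm{Proj}$ as above, every $t_0\ge 0$ and every solution of the observer on an interval $[t_0,T]$ with such initial data, $$\|z(t)\|\le C e^{-\alpha(t-t_0)}\|z(t_0)\|\qquad\text{for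 all } t\in[t_0,T].$$ The thresholds and $C,\alpha$ depend only on the fixed data, $\varepsilon_R$, $B$ and (for $\underline{k_v},C,\alpha$) on the chosen gains. -/

import Mathlib

open Set MeasureTheory
open scoped Matrix

/-- Vectors of `ℝ³` with the Euclidean norm. -/
abbrev Vec3 := EuclideanSpace ℝ (Fin 3)

/-- Real `3 × 3` matrices. -/
abbrev Mat3 := Matrix (Fin 3) (Fin 3) ℝ

/-- The special orthogonal group `SO(3)`, as a set of matrices. -/
abbrev SO3 : Set Mat3 := {M | M ∈ Matrix.specialOrthogonalGroup (Fin 3) ℝ}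

noncomputable section

/-- The cross product on `ℝ³`. -/
def cross (x y : Vec3) : Vec3 := WithLp.toLp 2 (WithLp.ofLp x ⨯₃ WithLp.ofLp y)

/-- The matrix-vector product `M x`. -/
def act (M : Mat3) (x : Vec3) : Vec3 := WithLp.toLp 2 (M *ᵥ WithLp.ofLp x)

/-- The skew-symmetric matrix `[x]ₓ`, for which `[x]ₓ y = x × y`. -/
def skew (x : Vec3) : Mat3 :=
  !![0, -x 2, x 1;
     x 2, 0, -x 0;
     -x 1, x 0, 0]

theorem act_skew (x y : Vec3) : act (skew x) y = cross x y := by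
  ext i
  fin_cases i <;>
    simp [act, skew, cross, dotProduct, Fin.sum_univ_three, cross_apply] <;> ring

/-- The third vector of the standard basis. -/
def e3 : Vec3 := EuclideanSpace.single 2 1

/-- The normalized Euclidean distance `|R|_I` of a rotation `R` to the identity:
`|R|_I ^ 2 = tr ((I - R)ᵀ (I - R)) / 8 = ‖I - R‖_F ^ 2 / 8`. -/
def attNorm (R : Mat3) : ℝ := √(((1 - R)ᵀ * (1 - R)).trace / 8)

/-- The signals of the vehicle: attitude `R`, angular velocity `ω` (body frame), linear velocity
`v` (inertial frame), apparent acceleration `ba` (body frame), and the constant gyro bias `bω`. -/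
structure RigidBody where
  R : ℝ → Mat3
  ω : ℝ → Vec3
  v : ℝ → Vec3
  ba : ℝ → Vec3
  bω : Vec3

namespace RigidBody

/-- The apparent acceleration in the inertial frame, `r_a = R b_a` (that is, `b_a = Rᵀ r_a`). -/
def ra (P : RigidBody) (t : ℝ) : Vec3 := act (P.R t) (P.ba t)

/-- The magnetometer measurement `b_m = Rᵀ r_m`. -/
def bm (P : RigidBody) (rm : Vec3) (t : ℝ) : Vec3 := act (P.R t)ᵀ rm

/-- The gyroscope measurement `ω_y = ω + b_ω`. -/
def ωy (P : RigidBody) (t : ℝ) : Vec3 := P.ω t + P.bω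

/-- The rigid body dynamics `v' = g e₃ + R b_a`, `R' = R [ω]ₓ` on `SO(3)`, for all `t ≥ 0`
(one-sided derivatives at `t = 0`). -/
structure IsMotion (P : RigidBody) (g : ℝ) : Prop where
  mem_SO3 : ∀ t, 0 ≤ t → P.R t ∈ SO3
  v_ode : ∀ t, 0 ≤ t → HasDerivWithinAt P.v (g • e3 + act (P.R t) (P.ba t)) (Ici 0) t
  R_ode : ∀ t, 0 ≤ t → ∀ i j,
    HasDerivWithinAt (fun s => P.R s i j) ((P.R t * skew (P.ω t)) i j) (Ici 0) t

/-- Observability condition. -/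
def Observable (P : RigidBody) (rm : Vec3) (c₀ : ℝ) : Prop :=
  ∀ t, 0 ≤ t → c₀ ≤ ‖cross rm (P.ra t)‖ / (‖rm‖ * ‖P.ra t‖)

/-- Bounds on the apparent acceleration and on its time derivative. -/
def BoundedAccel (P : RigidBody) (c₁ c₂ c₃ : ℝ) : Prop :=
  (∀ t, 0 ≤ t → c₁ ≤ ‖P.ra t‖ ∧ ‖P.ra t‖ ≤ c₂) ∧
  ∃ ra' : ℝ → Vec3, ∀ t, 0 ≤ t → HasDerivWithinAt P.ra (ra' t) (Ici 0) t ∧ ‖ra' t‖ ≤ c₃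

/-- Bounds on the angular velocity and on the gyro bias. -/
def BoundedGyro (P : RigidBody) (c₄ c₅ : ℝ) : Prop :=
  (∀ t, 0 ≤ t → ‖P.ω t‖ ≤ c₄) ∧ ‖P.bω‖ ≤ c₅

end RigidBody

/-- `Proj b μ` is a parameter projection for the unknown parameter `bω` and the radius `c₅`.
Here `b` is the current estimate and `μ` the nominal right-hand side. -/
structure IsParamProjection (Proj : Vec3 → Vec3 → Vec3) (c₅ : ℝ) (bω : Vec3) : Prop where
  /-- Estimates that start in the ball of radius `c₅` stay there, for every continuous input
  (solutions of `b' = Proj b μ` are understood in the sense of Carathéodory). -/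
  bounded : ∀ (t₀ T : ℝ) (μ b : ℝ → Vec3), t₀ ≤ T → ContinuousOn μ (Icc t₀ T) →
    AbsolutelyContinuousOnInterval b t₀ T →
    (∀ᵐ t ∂(volume : Measure ℝ), t ∈ Icc t₀ T → HasDerivAt b (Proj (b t) (μ t)) t) →
    ‖b t₀‖ ≤ c₅ → ∀ t ∈ Icc t₀ T, ‖b t‖ ≤ c₅
  inner_le : ∀ b μ : Vec3, ‖b‖ ≤ c₅ → inner ℝ (b - bω) (Proj b μ) ≤ inner ℝ (b - bω) μ
  norm_le : ∀ b μ : Vec3, ‖b‖ ≤ c₅ → ‖Proj b μ‖ ≤ ‖μ‖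

/-- The constant parameters of the observer. -/
structure ObserverParams where
  /-- gravity constant -/
  g : ℝ
  /-- magnetic field in the inertial frame -/
  rm : Vec3
  ρ₁ : ℝ
  ρ₂ : ℝ
  kb : ℝ
  kR : ℝ
  kv : ℝ

/-- The state signals of the observer: estimates of attitude, velocity and gyro bias. -/
structure ObserverState where
  Rh : ℝ → Mat3
  vh : ℝ → Vec3
  bh : ℝ → Vec3

namespace ObserverState

variable (X : ObserverState) (q : ObserverParams) (P : RigidBody)

/-- `r̂_a = k_v (v - v̂) + R̂ b_a`. -/
def rah (t : ℝ) : Vec3 := q.kv • (P.v t - X.vh t) + act (X.Rh t) (P.ba t)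

/-- `σ_R = ρ₁ (b_m × R̂ᵀ r_m) + ρ₂ (b_a × R̂ᵀ r̂_a)`. -/
def σR (t : ℝ) : Vec3 :=
  q.ρ₁ • cross (P.bm q.rm t) (act (X.Rh t)ᵀ q.rm) +
    q.ρ₂ • cross (P.ba t) (act (X.Rh t)ᵀ (X.rah q P t))

/-- `σ_v = v - v̂ + (k_R / k_v²) R̂ [σ_R]ₓ b_a`. -/
def σv (t : ℝ) : Vec3 :=
  P.v t - X.vh t + (q.kR / q.kv ^ 2) • act (X.Rh t * skew (X.σR q P t)) (P.ba t)

/-- `X` solves the observer equations, driven by the measurements of the rigid body `P`, on the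
time interval `[t₀, T]`, in the sense of Carathéodory (this includes classical solutions):
`v̂' = g e₃ + R̂ b_a + k_v σ_v`, `R̂' = R̂ [ω_y - b̂ + k_R σ_R]ₓ`, `b̂' = Proj (b̂, -k_b σ_R)`. -/
structure IsSolution (Proj : Vec3 → Vec3 → Vec3) (t₀ T : ℝ) : Prop where
  mem_SO3 : ∀ t ∈ Icc t₀ T, X.Rh t ∈ SO3
  vh_ac : AbsolutelyContinuousOnInterval X.vh t₀ T
  Rh_ac : ∀ i j, AbsolutelyContinuousOnInterval (fun t => X.Rh t i j) t₀ T
  bh_ac : AbsolutelyContinuousOnInterval X.bh t₀ T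
  vh_ode : ∀ᵐ t ∂(volume : Measure ℝ), t ∈ Icc t₀ T →
    HasDerivAt X.vh (q.g • e3 + act (X.Rh t) (P.ba t) + q.kv • X.σv q P t) t
  Rh_ode : ∀ᵐ t ∂(volume : Measure ℝ), t ∈ Icc t₀ T → ∀ i j,
    HasDerivAt (fun s => X.Rh s i j)
      ((X.Rh t * skew (P.ωy t - X.bh t + q.kR • X.σR q P t)) i j) t
  bh_ode : ∀ᵐ t ∂(volume : Measure ℝ), t ∈ Icc t₀ T →
    HasDerivAt X.bh (Proj (X.bh t) (-(q.kb • X.σR q P t))) t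

/-- Attitude error `R̃ = R R̂ᵀ`. -/
def errR (t : ℝ) : Mat3 := P.R t * (X.Rh t)ᵀ

/-- Gyro-bias error `b̃ = b_ω - b̂`. -/
def errb (t : ℝ) : Vec3 := P.bω - X.bh t

/-- Apparent acceleration error `r̃_a = r_a - r̂_a`. -/
def erra (t : ℝ) : Vec3 := P.ra t - X.rah q P t

/-- Distance of the error state `(R̃, b̃, r̃_a)` to the equilibrium `(I, 0, 0)`. -/
def errDist (t : ℝ) : ℝ :=
  √(attNorm (X.errR P t) ^ 2 + ‖X.errb P t‖ ^ 2 + ‖X.erra q P t‖ ^ 2)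

end ObserverState

end

/-!
The proof rewrites the closed loop as an closed system of error equations in the inertial frame
(`IsErrorSystem`). With `Q = R R̂ᵀ`, the rotated bias error `β = R b̃`, the acceleration error
`r = r̃_a`, `a = r_a` and `s = R σ_R`, it reads
`Q' = -[β + k_R s]ₓ Q`, `β' = (R ω) × β + d`, `r' = -k_v r + (1 - Qᵀ) a' - Qᵀ (β × a)`.
The correction in `σ_v` makes `k_R` disappear from the last equation, so that `k_v` can be chosen
after `k_R`. Here `s = I - ρ₂ a × Q r`, where `I = ρ₁ r_m × Q r_m + ρ₂ a × Q a` is the innovation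
for an exact acceleration, and `d` is the projected adaptation, with `‖d‖ ≤ k_b ‖s‖` and
`β ⬝ d ≤ k_b β ⬝ s`; the projection also yields the a priori bound `‖β‖ ≤ 2 c₅`.

All geometric estimates come from the unit quaternion `(η, ε)` of `Q`, which exists for `|Q|_I < 1`
and satisfies `|Q|_I = ‖ε‖` (`exists_quaternion`). Observability makes the quadratic form
`ρ₁ ‖r_m × e‖² + ρ₂ ‖a × e‖²` coercive with a constant `l`
(`isCoercivePair_of_observable`), hence `axial Q ⬝ I ≥ 4 l (1 - |Q|_I²) |Q|_I²`.

Away from the critical set: `(|Q|_I²)' = -(β + k_R s) ⬝ axial Q / 2`. On a set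
`|Q|_I² + p ‖r‖² ≤ u < 1` with small `p`, a large `k_R` beats the bounded bias error, and a large
`k_v` beats the acceleration error, so this set is forward invariant
(`IsErrorSystem.attNorm_sq_le`).

Convergence: on that set the Lyapunov function is
`V = W + ‖β‖² / (4 k_b) + δ axial Q ⬝ β + ‖r‖²`, with the weighted potential
`W = (ρ₁ r_m ⬝ (r_m - Q r_m) + ρ₂ a ⬝ (a - Q a)) / 2`, whose gradient is the innovation. The two
terms `± β ⬝ I / 2` in the rates of `W` and of the bias energy cancel exactly, which leaves
`-k_R ‖I‖² / 2`; the cross term with `δ = κ / k_R` contributes `-δ ‖β‖²`; the remaining terms are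
dominated for `k_R` large, and then for `k_v` large (`rateBound_le`). Thus `V' ≤ -c V` with `c > 0`, and `V` is
equivalent to the squared distance to the equilibrium (`IsErrorSystem.errDist_le`).

The solutions are only absolutely continuous, so differential inequalities hold almost everywhere
and are integrated with the fundamental theorem of calculus for absolutely continuous functions.
-/

noncomputable section

/-! ### Absolutely continuous functions and differential inequalities -/

section Comparison

variable {a b : ℝ}

theorem absolutelyContinuousOnInterval_const {X : Type*} [PseudoMetricSpace X] (c : X) :
    AbsolutelyContinuousOnInterval (fun _ : ℝ => c) a b :=
  ((LipschitzWith.const c).lipschitzOnWith (K := 0)).absolutelyContinuousOnInterval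

theorem LipschitzWith.comp_absolutelyContinuousOnInterval {X Y : Type*} [PseudoMetricSpace X]
    [PseudoMetricSpace Y] {K : NNReal} {φ : X → Y} (hφ : LipschitzWith K φ) {f : ℝ → X}
    (hf : AbsolutelyContinuousOnInterval f a b) :
    AbsolutelyContinuousOnInterval (fun t => φ (f t)) a b := by
  unfold AbsolutelyContinuousOnInterval at hf ⊢
  refine squeeze_zero (fun E => Finset.sum_nonneg fun i _ => dist_nonneg) (fun E => ?_)
    (by simpa using hf.const_mul (K : ℝ))
  rw [Finset.mul_sum]
  exact Finset.sum_le_sum fun i _ => hφ.dist_le_mul _ _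

theorem AbsolutelyContinuousOnInterval.congr {X : Type*} [PseudoMetricSpace X] {f g : ℝ → X}
    (hab : a ≤ b) (hf : AbsolutelyContinuousOnInterval f a b) (h : EqOn f g (Icc a b)) :
    AbsolutelyContinuousOnInterval g a b := by
  rw [absolutelyContinuousOnInterval_iff] at hf ⊢
  intro ε hε
  obtain ⟨δ, hδ, H⟩ := hf ε hε
  refine ⟨δ, hδ, fun E hE hlt => ?_⟩
  have hmem := hE.1
  rw [uIcc_of_le hab] at hmem
  refine lt_of_eq_of_lt (Finset.sum_congr rfl fun i hi => ?_) (H E hE hlt)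
  rw [h (hmem i hi).1, h (hmem i hi).2]

/-- A function on `[a, b]` with a bounded one-sided derivative is absolutely continuous. -/
theorem absolutelyContinuousOnInterval_of_hasDerivWithinAt {E : Type*} [NormedAddCommGroup E]
    [NormedSpace ℝ E] {f f' : ℝ → E} {K : ℝ} {s : Set ℝ} (hab : a ≤ b) (hs : Icc a b ⊆ s)
    (hf : ∀ t ∈ Icc a b, HasDerivWithinAt f (f' t) s t) (hK : ∀ t ∈ Icc a b, ‖f' t‖ ≤ K) :
    AbsolutelyContinuousOnInterval f a b := by
  have hK0 : 0 ≤ K := (norm_nonneg _).trans (hK a (left_mem_Icc.2 hab))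
  refine LipschitzOnWith.absolutelyContinuousOnInterval (K := ⟨K, hK0⟩) ?_
  rw [uIcc_of_le hab]
  exact (convex_Icc a b).lipschitzOnWith_of_nnnorm_hasDerivWithin_le
    (fun t ht => (hf t ht).mono hs) (fun t ht => hK t ht)

theorem AbsolutelyContinuousOnInterval.le_of_ae_deriv_nonpos {f : ℝ → ℝ} (hab : a ≤ b)
    (hf : AbsolutelyContinuousOnInterval f a b)
    (h : ∀ᵐ t ∂(volume : Measure ℝ), t ∈ Icc a b → ∃ f', HasDerivAt f f' t ∧ f' ≤ 0) :
    f b ≤ f a := by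
  have h1 := hf.integral_deriv_eq_sub
  have h2 : 0 ≤ ∫ t in a..b, -deriv f t := by
    refine intervalIntegral.integral_nonneg_of_ae_restrict hab ?_
    refine (ae_restrict_iff' measurableSet_Icc).2 ?_
    filter_upwards [h] with t ht hmem
    obtain ⟨f', hd, hle⟩ := ht hmem
    simpa [hd.deriv] using hle
  rw [intervalIntegral.integral_neg] at h2
  linarith

/-- Grönwall's inequality for the affine differential inequality `f' ≤ -κ f + D`, which has to
hold only almost everywhere, since `f` is absolutely continuous. -/
theorem AbsolutelyContinuousOnInterval.le_of_ae_deriv_le {f : ℝ → ℝ} {κ D : ℝ} (hκ : κ ≠ 0)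
    (hab : a ≤ b) (hf : AbsolutelyContinuousOnInterval f a b)
    (h : ∀ᵐ t ∂(volume : Measure ℝ), t ∈ Icc a b →
      ∃ f', HasDerivAt f f' t ∧ f' ≤ -κ * f t + D) :
    f b ≤ D / κ + Real.exp (-κ * (b - a)) * (f a - D / κ) := by
  have hexp : AbsolutelyContinuousOnInterval (fun t => Real.exp (κ * t)) a b := by
    apply ContDiffOn.absolutelyContinuousOnInterval
    fun_prop
  have hg : AbsolutelyContinuousOnInterval (fun t => Real.exp (κ * t) * (f t - D / κ)) a b :=
    hexp.fun_mul (hf.fun_sub (absolutelyContinuousOnInterval_const _))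
  have key := hg.le_of_ae_deriv_nonpos hab (by
    filter_upwards [h] with t ht hmem
    obtain ⟨f', hd, hle⟩ := ht hmem
    have he : HasDerivAt (fun t => Real.exp (κ * t)) (Real.exp (κ * t) * κ) t := by
      simpa using ((hasDerivAt_id t).const_mul κ).exp
    refine ⟨_, he.mul (hd.sub_const _), ?_⟩
    have : Real.exp (κ * t) * κ * (f t - D / κ) + Real.exp (κ * t) * f'
        = Real.exp (κ * t) * (f' - (-κ * f t + D)) := by field_simp; ring
    rw [this]
    exact mul_nonpos_of_nonneg_of_nonpos (Real.exp_pos _).le (by linarith))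
  have e1 : Real.exp (-κ * (b - a)) = Real.exp (κ * a) / Real.exp (κ * b) := by
    rw [← Real.exp_sub]; ring_nf
  have e2 : f b - D / κ ≤ Real.exp (κ * a) / Real.exp (κ * b) * (f a - D / κ) := by
    rw [div_mul_eq_mul_div, le_div_iff₀ (Real.exp_pos _)]
    linarith
  rw [e1]; linarith

/-- Sublevel sets are forward invariant when the differential inequality `f' ≤ -κ f + D` is known
only on the sublevel set itself, provided that its level lies above the ultimate bound `D / κ`. -/
theorem AbsolutelyContinuousOnInterval.le_of_ae_deriv_le_on_sublevel {f : ℝ → ℝ} {κ D u : ℝ}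
    (hκ : 0 < κ) (hf : AbsolutelyContinuousOnInterval f a b)
    (ha : f a < u) (hu : D / κ < u)
    (h : ∀ᵐ t ∂(volume : Measure ℝ), t ∈ Icc a b → f t ≤ u →
      ∃ f', HasDerivAt f f' t ∧ f' ≤ -κ * f t + D) :
    ∀ t ∈ Icc a b, f t ≤ u := by
  intro t ht
  have hab : a ≤ b := ht.1.trans ht.2
  have hc : ContinuousOn f (Icc a b) := uIcc_of_le hab ▸ hf.continuousOn
  have hcl : IsClosed ({s | f s ≤ u} ∩ Icc a b) := by
    rw [inter_comm]
    exact hc.preimage_isClosed_of_isClosed isClosed_Icc isClosed_Iic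
  -- On every initial segment inside the sublevel set, Grönwall's inequality is strict.
  refine hcl.Icc_subset_of_forall_mem_nhdsGT_of_Icc_subset ha.le (fun r hr hsub => ?_) ht
  have hr' : r ∈ Icc a b := ⟨hr.1, hr.2.le⟩
  have hgr := (hf.mono (c := a) (d := r) (by
    rw [uIcc_of_le hab, uIcc_of_le hr.1]; exact Icc_subset_Icc_right hr.2.le)).le_of_ae_deriv_le
    hκ.ne' hr.1 (by
      filter_upwards [h] with s hs hmem
      exact hs ⟨hmem.1, hmem.2.trans hr.2.le⟩ (hsub hmem))
  have he0 := Real.exp_pos (-κ * (r - a))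
  have he1 : Real.exp (-κ * (r - a)) ≤ 1 :=
    Real.exp_le_one_iff.2 (by nlinarith [hr.1])
  have hlt : f r < u := by nlinarith
  have hev : ∀ᶠ s in nhdsWithin r (Icc a b), f s < u := (hc r hr').eventually_lt_const hlt
  have hle : nhdsWithin r (Ioi r) ≤ nhdsWithin r (Icc a b) :=
    nhdsWithin_le_of_mem (Filter.mem_of_superset (Ioo_mem_nhdsGT hr.2)
      fun s hs => ⟨hr.1.trans hs.1.le, hs.2.le⟩)
  filter_upwards [hle hev] with s hs using le_of_lt hs

end Comparison

/-! ### Vector algebra in `ℝ³` -/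

theorem inner_vec3 (x y : Vec3) : inner ℝ x y = x 0 * y 0 + x 1 * y 1 + x 2 * y 2 := by
  simp [PiLp.inner_apply, Fin.sum_univ_three, mul_comm]

theorem norm_sq_vec3 (x : Vec3) : ‖x‖ ^ 2 = x 0 ^ 2 + x 1 ^ 2 + x 2 ^ 2 := by
  rw [← real_inner_self_eq_norm_sq, inner_vec3]; ring

theorem act_apply (M : Mat3) (x : Vec3) (i : Fin 3) :
    act M x i = M i 0 * x 0 + M i 1 * x 1 + M i 2 * x 2 := by
  simp [act, Matrix.mulVec, dotProduct, Fin.sum_univ_three]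

theorem cross_zero (x y : Vec3) : cross x y 0 = x 1 * y 2 - x 2 * y 1 := by
  simp [cross, cross_apply]

theorem cross_one (x y : Vec3) : cross x y 1 = x 2 * y 0 - x 0 * y 2 := by
  simp [cross, cross_apply]

theorem cross_two (x y : Vec3) : cross x y 2 = x 0 * y 1 - x 1 * y 0 := by
  simp [cross, cross_apply]

theorem vec3_ext {x y : Vec3} (h0 : x 0 = y 0) (h1 : x 1 = y 1) (h2 : x 2 = y 2) : x = y := by
  ext i; fin_cases i <;> assumption

theorem act_add (M : Mat3) (x y : Vec3) : act M (x + y) = act M x + act M y := by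
  simp [act, Matrix.mulVec_add]

theorem act_sub (M : Mat3) (x y : Vec3) : act M (x - y) = act M x - act M y := by
  simp [act, Matrix.mulVec_sub]

theorem act_neg (M : Mat3) (x : Vec3) : act M (-x) = -act M x := by
  simp [act, Matrix.mulVec_neg]

theorem act_smul (M : Mat3) (c : ℝ) (x : Vec3) : act M (c • x) = c • act M x := by
  simp [act, Matrix.mulVec_smul]

theorem act_mul (M N : Mat3) (x : Vec3) : act (M * N) x = act M (act N x) := by
  simp [act, Matrix.mulVec_mulVec]

theorem act_one (x : Vec3) : act 1 x = x := by
  simp [act]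

theorem cross_sub_right (x y z : Vec3) : cross x (y - z) = cross x y - cross x z := by
  simp [cross]

theorem mat3_ext_act {M N : Mat3} (h : ∀ w, act M w = act N w) : M = N := by
  ext i j
  have := congrArg (fun v : Vec3 => v i) (h (EuclideanSpace.single j 1))
  simpa [act] using this

theorem skew_transpose (x : Vec3) : (skew x)ᵀ = -skew x := by
  ext i j
  fin_cases i <;> fin_cases j <;> simp [skew]

theorem neg_act (M : Mat3) (x : Vec3) : act (-M) x = -act M x := by
  simp [act, Matrix.neg_mulVec]

theorem add_act (M N : Mat3) (x : Vec3) : act (M + N) x = act M x + act N x := by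
  simp [act, Matrix.add_mulVec]

theorem cross_add_left (x y z : Vec3) : cross (x + y) z = cross x z + cross y z := by
  simp [cross]

theorem cross_sub_left (x y z : Vec3) : cross (x - y) z = cross x z - cross y z := by
  simp [cross]

theorem cross_smul_left (c : ℝ) (x z : Vec3) : cross (c • x) z = c • cross x z := by
  simp [cross]

theorem inner_cross_self_right (x y : Vec3) : inner ℝ x (cross y x) = 0 := by
  rw [inner_vec3, cross_zero, cross_one, cross_two]; ring

theorem norm_cross_sq (x y : Vec3) :
    ‖cross x y‖ ^ 2 = ‖x‖ ^ 2 * ‖y‖ ^ 2 - inner ℝ x y ^ 2 := by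
  simp only [inner_vec3, norm_sq_vec3, cross_zero, cross_one, cross_two]; ring

theorem norm_cross_le (x y : Vec3) : ‖cross x y‖ ≤ ‖x‖ * ‖y‖ := by
  refine abs_le_of_sq_le_sq' ?_ (by positivity) |>.2
  rw [norm_cross_sq, mul_pow]
  linarith [sq_nonneg (inner ℝ x y : ℝ)]

/-- Two directions that are not parallel determine a rotation axis: a quantitative form, in which
the squared sine of the angle between `m` and `a` bounds the size of `e` by its cross products
with `m` and `a`. -/
theorem norm_sq_mul_norm_cross_sq_le (e m a : Vec3) :
    ‖e‖ ^ 2 * ‖cross m a‖ ^ 2 ≤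
      3 * ‖a‖ ^ 2 * ‖cross m e‖ ^ 2 + 2 * ‖m‖ ^ 2 * ‖cross a e‖ ^ 2 := by
  have h1 : ‖e‖ ^ 2 * ‖cross m a‖ ^ 2
      = ‖cross e (cross m a)‖ ^ 2 + inner ℝ e (cross m a) ^ 2 := by
    rw [norm_cross_sq e (cross m a)]; ring
  have h2 : cross e (cross m a) = cross a (cross m e) - cross m (cross a e) := by
    refine vec3_ext ?_ ?_ ?_ <;> simp only [PiLp.sub_apply, cross_zero, cross_one, cross_two] <;>
      ring
  have h3 : (inner ℝ e (cross m a) : ℝ) = -inner ℝ a (cross m e) := by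
    simp only [inner_vec3, cross_zero, cross_one, cross_two]; ring
  have h4 : ‖cross e (cross m a)‖ ≤ ‖a‖ * ‖cross m e‖ + ‖m‖ * ‖cross a e‖ := by
    rw [h2]
    exact (norm_sub_le _ _).trans (add_le_add (norm_cross_le _ _) (norm_cross_le _ _))
  have h5 : (inner ℝ e (cross m a) : ℝ) ^ 2 ≤ (‖a‖ * ‖cross m e‖) ^ 2 := by
    rw [h3, neg_sq]
    exact sq_le_sq.2 ((abs_real_inner_le_norm _ _).trans (le_abs_self _))
  have h6 : ‖cross e (cross m a)‖ ^ 2 ≤ (‖a‖ * ‖cross m e‖ + ‖m‖ * ‖cross a e‖) ^ 2 :=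
    pow_le_pow_left₀ (norm_nonneg _) h4 2
  nlinarith [sq_nonneg (‖a‖ * ‖cross m e‖ - ‖m‖ * ‖cross a e‖)]

/-! ### Rotations -/

theorem transpose_mul_self_of_mem_SO3 {Q : Mat3} (hQ : Q ∈ SO3) : Qᵀ * Q = 1 :=
  (Matrix.mem_orthogonalGroup_iff' (Fin 3) ℝ).1
    (Matrix.mem_specialOrthogonalGroup_iff.1 hQ).1

theorem mul_transpose_self_of_mem_SO3 {Q : Mat3} (hQ : Q ∈ SO3) : Q * Qᵀ = 1 :=
  (Matrix.mem_orthogonalGroup_iff (Fin 3) ℝ).1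
    (Matrix.mem_specialOrthogonalGroup_iff.1 hQ).1

theorem transpose_mem_SO3 {Q : Mat3} (hQ : Q ∈ SO3) : Qᵀ ∈ SO3 := by
  refine Matrix.mem_specialOrthogonalGroup_iff.2
    ⟨(Matrix.mem_orthogonalGroup_iff (Fin 3) ℝ).2 ?_, ?_⟩
  · change Qᵀ * Qᵀᵀ = 1
    rw [Matrix.transpose_transpose, transpose_mul_self_of_mem_SO3 hQ]
  · rw [Matrix.det_transpose]; exact (Matrix.mem_specialOrthogonalGroup_iff.1 hQ).2

theorem adjugate_of_mem_SO3 {Q : Mat3} (hQ : Q ∈ SO3) : Q.adjugate = Qᵀ := by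
  have hdet : Q.det = 1 := (Matrix.mem_specialOrthogonalGroup_iff.1 hQ).2
  have h : Q.adjugate * Q = 1 := by rw [Matrix.adjugate_mul, hdet, one_smul]
  calc Q.adjugate = Q.adjugate * (Q * Qᵀ) := by rw [mul_transpose_self_of_mem_SO3 hQ, mul_one]
    _ = Qᵀ := by rw [← mul_assoc, h, one_mul]

theorem inner_act_left (M : Mat3) (x y : Vec3) : inner ℝ (act M x) y = inner ℝ x (act Mᵀ y) := by
  simp only [inner_vec3, act_apply, Matrix.transpose_apply]; ring

theorem act_transpose_act {Q : Mat3} (hQ : Q ∈ SO3) (x : Vec3) : act Qᵀ (act Q x) = x := by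
  rw [← act_mul, transpose_mul_self_of_mem_SO3 hQ, act_one]

theorem act_act_transpose {Q : Mat3} (hQ : Q ∈ SO3) (x : Vec3) : act Q (act Qᵀ x) = x := by
  rw [← act_mul, mul_transpose_self_of_mem_SO3 hQ, act_one]

theorem inner_act_act {Q : Mat3} (hQ : Q ∈ SO3) (x y : Vec3) :
    inner ℝ (act Q x) (act Q y) = inner ℝ x y := by
  rw [inner_act_left, act_transpose_act hQ]

theorem norm_act {Q : Mat3} (hQ : Q ∈ SO3) (x : Vec3) : ‖act Q x‖ = ‖x‖ := by
  rw [norm_eq_sqrt_real_inner, norm_eq_sqrt_real_inner (F := Vec3), inner_act_act hQ]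

/-- The entries of a rotation are its own cofactors. -/
theorem cofactor_of_mem_SO3 {Q : Mat3} (hQ : Q ∈ SO3) :
    (Q 0 0 = Q 1 1 * Q 2 2 - Q 1 2 * Q 2 1 ∧ Q 0 1 = Q 1 2 * Q 2 0 - Q 1 0 * Q 2 2 ∧
      Q 0 2 = Q 1 0 * Q 2 1 - Q 1 1 * Q 2 0) ∧
    (Q 1 0 = Q 0 2 * Q 2 1 - Q 0 1 * Q 2 2 ∧ Q 1 1 = Q 0 0 * Q 2 2 - Q 0 2 * Q 2 0 ∧
      Q 1 2 = Q 0 1 * Q 2 0 - Q 0 0 * Q 2 1) ∧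
    (Q 2 0 = Q 0 1 * Q 1 2 - Q 0 2 * Q 1 1 ∧ Q 2 1 = Q 0 2 * Q 1 0 - Q 0 0 * Q 1 2 ∧
      Q 2 2 = Q 0 0 * Q 1 1 - Q 0 1 * Q 1 0) := by
  have h := adjugate_of_mem_SO3 hQ
  have e (i j) := (congrFun (congrFun h j) i).symm
  simp only [Matrix.transpose_apply] at e
  refine ⟨⟨?_, ?_, ?_⟩, ⟨?_, ?_, ?_⟩, ⟨?_, ?_, ?_⟩⟩ <;> rw [e] <;>
    simp [Matrix.adjugate_fin_three] <;> ring

theorem act_cross {Q : Mat3} (hQ : Q ∈ SO3) (x y : Vec3) :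
    act Q (cross x y) = cross (act Q x) (act Q y) := by
  obtain ⟨⟨h00, h01, h02⟩, ⟨h10, h11, h12⟩, h20, h21, h22⟩ := cofactor_of_mem_SO3 hQ
  refine vec3_ext ?_ ?_ ?_ <;> simp only [act_apply, cross_zero, cross_one, cross_two]
  · rw [h00, h01, h02]; ring
  · rw [h10, h11, h12]; ring
  · rw [h20, h21, h22]; ring

/-- The axial vector of a matrix, for which `[axial Q]ₓ = (Q - Qᵀ) / 2`. -/
def axial (Q : Mat3) : Vec3 :=
  !₂[(Q 2 1 - Q 1 2) / 2, (Q 0 2 - Q 2 0) / 2, (Q 1 0 - Q 0 1) / 2]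

theorem axial_zero (Q : Mat3) : axial Q 0 = (Q 2 1 - Q 1 2) / 2 := by simp [axial]

theorem axial_one (Q : Mat3) : axial Q 1 = (Q 0 2 - Q 2 0) / 2 := by simp [axial]

theorem axial_two (Q : Mat3) : axial Q 2 = (Q 1 0 - Q 0 1) / 2 := by simp [axial]

theorem trace_skew_mul (u : Vec3) (Q : Mat3) :
    (skew u * Q).trace = -2 * inner ℝ u (axial Q) := by
  simp only [Matrix.trace_fin_three, Matrix.mul_apply, Fin.sum_univ_three, inner_vec3,
    axial_zero, axial_one, axial_two]
  simp [skew]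
  ring

theorem inner_axial_skew_mul (u w : Vec3) (Q : Mat3) :
    inner ℝ (axial (skew u * Q)) w = (Q.trace * inner ℝ u w - inner ℝ (act Q u) w) / 2 := by
  simp only [Matrix.trace_fin_three, Matrix.mul_apply, Fin.sum_univ_three, inner_vec3,
    axial_zero, axial_one, axial_two, act_apply]
  simp [skew]
  ring

theorem trace_of_mem_SO3 {Q : Mat3} (hQ : Q ∈ SO3) : Q.trace = 3 - 4 * attNorm Q ^ 2 := by
  have h : ((1 - Q)ᵀ * (1 - Q)).trace = 2 * (3 - Q.trace) := by
    have : (1 - Q)ᵀ * (1 - Q) = 1 - Q - Qᵀ + Qᵀ * Q := by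
      rw [Matrix.transpose_sub, Matrix.transpose_one]; noncomm_ring
    rw [this, transpose_mul_self_of_mem_SO3 hQ]
    simp [Matrix.trace_transpose]
    ring
  have h0 : 0 ≤ ((1 - Q)ᵀ * (1 - Q)).trace / 8 := by
    simp only [Matrix.trace_fin_three, Matrix.mul_apply, Fin.sum_univ_three,
      Matrix.transpose_apply]
    simp only [← sq]; positivity
  rw [attNorm, Real.sq_sqrt h0, h]; ring

theorem attNorm_nonneg (Q : Mat3) : 0 ≤ attNorm Q := Real.sqrt_nonneg _

/-- Euler–Rodrigues parameters: a rotation by an angle smaller than `π` is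
`1 + 2η [ε]ₓ + 2 [ε]ₓ²` for a unit quaternion `(η, ε)`, whose vector part has norm `|Q|_I`. -/
theorem exists_quaternion {Q : Mat3} (hQ : Q ∈ SO3) (h : attNorm Q < 1) :
    ∃ (η : ℝ) (ε : Vec3), η ^ 2 + ‖ε‖ ^ 2 = 1 ∧ attNorm Q = ‖ε‖ ∧
      Q = 1 + (2 * η) • skew ε + (2 : ℝ) • (skew ε * skew ε) := by
  have hx : attNorm Q ^ 2 < 1 := by nlinarith [attNorm_nonneg Q]
  have htr := trace_of_mem_SO3 hQ
  obtain ⟨η, hη0, hη⟩ : ∃ η : ℝ, 0 < η ∧ η ^ 2 = 1 - attNorm Q ^ 2 :=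
    ⟨√(1 - attNorm Q ^ 2), Real.sqrt_pos.2 (by linarith), Real.sq_sqrt (by linarith)⟩
  have ht : Q.trace = 4 * η ^ 2 - 1 := by rw [htr, hη]; ring
  rw [Matrix.trace_fin_three] at ht
  obtain ⟨⟨h00, h01, h02⟩, ⟨h10, h11, h12⟩, h20, h21, h22⟩ := cofactor_of_mem_SO3 hQ
  have o (i j) := congrFun (congrFun (mul_transpose_self_of_mem_SO3 hQ) i) j
  have o' (i j) := congrFun (congrFun (transpose_mul_self_of_mem_SO3 hQ) i) j
  simp only [Matrix.mul_apply, Fin.sum_univ_three, Matrix.transpose_apply, Matrix.one_apply]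
    at o o'
  set ε : Vec3 := (1 / (2 * η)) • axial Q with hε
  have e0 : 4 * η * ε 0 = Q 2 1 - Q 1 2 := by
    simp only [hε, PiLp.smul_apply, axial_zero, smul_eq_mul]; field_simp; ring
  have e1 : 4 * η * ε 1 = Q 0 2 - Q 2 0 := by
    simp only [hε, PiLp.smul_apply, axial_one, smul_eq_mul]; field_simp; ring
  have e2 : 4 * η * ε 2 = Q 1 0 - Q 0 1 := by
    simp only [hε, PiLp.smul_apply, axial_two, smul_eq_mul]; field_simp; ring
  clear_value ε
  have hη4 : 16 * η ^ 2 ≠ 0 := by positivity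
  have o00 := o 0 0
  have o11 := o 1 1
  have o22 := o 2 2
  have o01 := o 0 1
  have o02 := o 0 2
  have o12 := o 1 2
  have p00 := o' 0 0
  have p11 := o' 1 1
  have p22 := o' 2 2
  have p01 := o' 0 1
  have p02 := o' 0 2
  have p12 := o' 1 2
  simp only [Fin.isValue, ↓reduceIte, Fin.reduceEq]
    at o00 o11 o22 o01 o02 o12 p00 p11 p22 p01 p02 p12
  -- The entries of the polynomial identity `(1 + tr Q) (Q + Qᵀ - 2) = (Q - Qᵀ)²`.
  have d0 : 8 * η ^ 2 * (1 - Q 0 0) = (Q 0 2 - Q 2 0) ^ 2 + (Q 1 0 - Q 0 1) ^ 2 := by grind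
  have d1 : 8 * η ^ 2 * (1 - Q 1 1) = (Q 2 1 - Q 1 2) ^ 2 + (Q 1 0 - Q 0 1) ^ 2 := by grind
  have d2 : 8 * η ^ 2 * (1 - Q 2 2) = (Q 2 1 - Q 1 2) ^ 2 + (Q 0 2 - Q 2 0) ^ 2 := by grind
  have d01 : 4 * η ^ 2 * (Q 0 1 + Q 1 0) = (Q 2 1 - Q 1 2) * (Q 0 2 - Q 2 0) := by grind
  have d02 : 4 * η ^ 2 * (Q 0 2 + Q 2 0) = (Q 2 1 - Q 1 2) * (Q 1 0 - Q 0 1) := by grind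
  have d12 : 4 * η ^ 2 * (Q 1 2 + Q 2 1) = (Q 0 2 - Q 2 0) * (Q 1 0 - Q 0 1) := by grind
  rw [← e0, ← e1] at d2 d01
  rw [← e0, ← e2] at d1 d02
  rw [← e1, ← e2] at d0 d12
  have key : Q = 1 + (2 * η) • skew ε + (2 : ℝ) • (skew ε * skew ε) := by
    ext i j
    fin_cases i <;> fin_cases j <;> simp [skew] <;> grind
  have hε2 : η ^ 2 + ‖ε‖ ^ 2 = 1 := by
    rw [norm_sq_vec3]
    grind
  refine ⟨η, ε, hε2, ?_, key⟩
  rw [← abs_of_nonneg (norm_nonneg ε), ← abs_of_nonneg (attNorm_nonneg Q),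
    ← sq_eq_sq_iff_abs_eq_abs]
  linarith

section RotationEstimates

variable {η : ℝ} {ε : Vec3} {Q : Mat3}

theorem act_of_quaternion (hQ : Q = 1 + (2 * η) • skew ε + (2 : ℝ) • (skew ε * skew ε))
    (w : Vec3) : act Q w = w + (2 * η) • cross ε w + (2 : ℝ) • cross ε (cross ε w) := by
  rw [← act_skew ε w, ← act_skew ε, ← act_mul, hQ]
  simp [act, Matrix.add_mulVec, Matrix.smul_mulVec]

theorem axial_of_quaternion (hQ : Q = 1 + (2 * η) • skew ε + (2 : ℝ) • (skew ε * skew ε)) :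
    axial Q = (2 * η) • ε := by
  refine vec3_ext ?_ ?_ ?_ <;>
    simp only [axial_zero, axial_one, axial_two, PiLp.smul_apply, smul_eq_mul, hQ] <;>
    simp [skew] <;> ring

theorem norm_axial_of_quaternion
    (hQ : Q = 1 + (2 * η) • skew ε + (2 : ℝ) • (skew ε * skew ε)) :
    ‖axial Q‖ ^ 2 = 4 * η ^ 2 * ‖ε‖ ^ 2 := by
  rw [axial_of_quaternion hQ, norm_smul, mul_pow, Real.norm_eq_abs, sq_abs]; ring

/-- A rotation displaces `w` by the chord length `2 ‖ε × w‖`. -/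
theorem norm_act_sub_self_of_quaternion (h1 : η ^ 2 + ‖ε‖ ^ 2 = 1)
    (hQ : Q = 1 + (2 * η) • skew ε + (2 : ℝ) • (skew ε * skew ε)) (w : Vec3) :
    ‖act Q w - w‖ = 2 * ‖cross ε w‖ := by
  rw [norm_sq_vec3] at h1
  rw [← abs_of_nonneg (norm_nonneg (act Q w - w)), ← abs_of_nonneg
    (by positivity : 0 ≤ 2 * ‖cross ε w‖), ← sq_eq_sq_iff_abs_eq_abs, act_of_quaternion hQ, mul_pow,
    norm_sq_vec3, norm_sq_vec3]
  simp only [PiLp.add_apply, PiLp.sub_apply, PiLp.smul_apply, smul_eq_mul, cross_zero, cross_one,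
    cross_two]
  linear_combination 4 * ((ε 1 * w 2 - ε 2 * w 1) ^ 2 + (ε 2 * w 0 - ε 0 * w 2) ^ 2 +
    (ε 0 * w 1 - ε 1 * w 0) ^ 2) * h1

theorem inner_sub_act_add_of_quaternion
    (hQ : Q = 1 + (2 * η) • skew ε + (2 : ℝ) • (skew ε * skew ε)) (w z : Vec3) :
    inner ℝ w (z - act Q z) + inner ℝ z (w - act Q w) = 4 * inner ℝ (cross w ε) (cross z ε) := by
  rw [act_of_quaternion hQ, act_of_quaternion hQ]
  simp only [inner_vec3, PiLp.add_apply, PiLp.sub_apply, PiLp.smul_apply, smul_eq_mul, cross_zero,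
    cross_one, cross_two]
  ring

theorem inner_axial_cross_act_of_quaternion
    (hQ : Q = 1 + (2 * η) • skew ε + (2 : ℝ) • (skew ε * skew ε)) (w : Vec3) :
    inner ℝ (axial Q) (cross w (act Q w)) = 4 * η ^ 2 * ‖cross w ε‖ ^ 2 := by
  rw [act_of_quaternion hQ, axial_of_quaternion hQ]
  simp only [inner_vec3, norm_sq_vec3, PiLp.add_apply, PiLp.smul_apply, smul_eq_mul, cross_zero,
    cross_one, cross_two]
  ring

end RotationEstimates

/-! ### The attitude innovation and the weighted attitude potential -/

/-- The attitude innovation `ρ₁ m × Q m + ρ₂ a × Q a` generated by the two directions `m` and `a`;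
it is the innovation term `R σ_R` of the observer when the acceleration is known exactly. -/
def innovation (ρ₁ ρ₂ : ℝ) (m a : Vec3) (Q : Mat3) : Vec3 :=
  ρ₁ • cross m (act Q m) + ρ₂ • cross a (act Q a)

/-- The weighted attitude potential `ρ₁ m ⬝ (m - Q m) / 2 + ρ₂ a ⬝ (a - Q a) / 2`. Its gradient
along rotations is the attitude innovation. -/
def potential (ρ₁ ρ₂ : ℝ) (m a : Vec3) (Q : Mat3) : ℝ :=
  (ρ₁ * inner ℝ m (m - act Q m) + ρ₂ * inner ℝ a (a - act Q a)) / 2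

/-- The two weighted directions `m` and `a` determine the attitude, with constant `l`: the
quadratic form `e ↦ ρ₁ ‖m × e‖² + ρ₂ ‖a × e‖²` is bounded below by `l ‖e‖²`. -/
def IsCoercivePair (ρ₁ ρ₂ l : ℝ) (m a : Vec3) : Prop :=
  ∀ e : Vec3, l * ‖e‖ ^ 2 ≤ ρ₁ * ‖cross m e‖ ^ 2 + ρ₂ * ‖cross a e‖ ^ 2

theorem isCoercivePair_of_observable {ρ₁ ρ₂ c₀ c₁ : ℝ} (hρ₁ : 0 < ρ₁) (hρ₂ : 0 < ρ₂)
    (hc₀ : 0 < c₀) (hc₁ : 0 < c₁) {m a : Vec3} (ha : c₁ ≤ ‖a‖)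
    (h : c₀ ≤ ‖cross m a‖ / (‖m‖ * ‖a‖)) :
    IsCoercivePair ρ₁ ρ₂ (c₀ ^ 2 / (3 / (ρ₁ * ‖m‖ ^ 2) + 2 / (ρ₂ * c₁ ^ 2))) m a := by
  intro e
  have ha0 : 0 < ‖a‖ := hc₁.trans_le ha
  -- For `m = 0` the quotient in `h` is zero, by the convention on division by zero.
  have hm0 : 0 < ‖m‖ := by
    rcases (norm_nonneg m).eq_or_lt with h0 | h0
    · rw [← h0, zero_mul, div_zero] at h; linarith
    · exact h0
  have h1 : c₀ * (‖m‖ * ‖a‖) ≤ ‖cross m a‖ := (le_div_iff₀ (by positivity)).1 h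
  have h2 : (c₀ * (‖m‖ * ‖a‖)) ^ 2 ≤ ‖cross m a‖ ^ 2 := pow_le_pow_left₀ (by positivity) h1 2
  have h3 := norm_sq_mul_norm_cross_sq_le e m a
  have h4 : c₀ ^ 2 * ‖e‖ ^ 2 ≤ 3 * ‖cross m e‖ ^ 2 / ‖m‖ ^ 2 + 2 * ‖cross a e‖ ^ 2 / ‖a‖ ^ 2 := by
    rw [div_add_div _ _ (by positivity) (by positivity), le_div_iff₀ (by positivity)]
    nlinarith [mul_le_mul_of_nonneg_left h2 (sq_nonneg ‖e‖)]
  have h5 : 2 * ‖cross a e‖ ^ 2 / ‖a‖ ^ 2 ≤ 2 * ‖cross a e‖ ^ 2 / c₁ ^ 2 := by gcongr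
  have h6 : ρ₁ * ‖cross m e‖ ^ 2 ≤ ρ₁ * ‖cross m e‖ ^ 2 + ρ₂ * ‖cross a e‖ ^ 2 :=
    le_add_of_nonneg_right (by positivity)
  have h7 : ρ₂ * ‖cross a e‖ ^ 2 ≤ ρ₁ * ‖cross m e‖ ^ 2 + ρ₂ * ‖cross a e‖ ^ 2 :=
    le_add_of_nonneg_left (by positivity)
  rw [div_mul_eq_mul_div, div_le_iff₀ (by positivity)]
  have e1 : 3 * ‖cross m e‖ ^ 2 / ‖m‖ ^ 2 = 3 / (ρ₁ * ‖m‖ ^ 2) * (ρ₁ * ‖cross m e‖ ^ 2) := by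
    field_simp
  have e2 : 2 * ‖cross a e‖ ^ 2 / c₁ ^ 2 = 2 / (ρ₂ * c₁ ^ 2) * (ρ₂ * ‖cross a e‖ ^ 2) := by
    field_simp
  calc c₀ ^ 2 * ‖e‖ ^ 2 ≤ 3 / (ρ₁ * ‖m‖ ^ 2) * (ρ₁ * ‖cross m e‖ ^ 2)
        + 2 / (ρ₂ * c₁ ^ 2) * (ρ₂ * ‖cross a e‖ ^ 2) := by rw [← e1, ← e2]; linarith
    _ ≤ 3 / (ρ₁ * ‖m‖ ^ 2) * (ρ₁ * ‖cross m e‖ ^ 2 + ρ₂ * ‖cross a e‖ ^ 2)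
        + 2 / (ρ₂ * c₁ ^ 2) * (ρ₁ * ‖cross m e‖ ^ 2 + ρ₂ * ‖cross a e‖ ^ 2) := by gcongr
    _ = _ := by ring

section Estimates

variable {Q : Mat3} {ρ₁ ρ₂ l : ℝ} {m a : Vec3}

theorem norm_act_sub_self_le (hQ : Q ∈ SO3) (hlt : attNorm Q < 1) (w : Vec3) :
    ‖act Q w - w‖ ≤ 2 * attNorm Q * ‖w‖ := by
  obtain ⟨η, ε, h1, hn, hq⟩ := exists_quaternion hQ hlt
  rw [norm_act_sub_self_of_quaternion h1 hq, hn]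
  linarith [norm_cross_le ε w]

theorem norm_sub_act_transpose_le (hQ : Q ∈ SO3) (hlt : attNorm Q < 1) (w : Vec3) :
    ‖w - act Qᵀ w‖ ≤ 2 * attNorm Q * ‖w‖ := by
  have h : act Q (w - act Qᵀ w) = act Q w - w := by
    rw [act_sub, act_act_transpose hQ]
  rw [← norm_act hQ, h]
  exact norm_act_sub_self_le hQ hlt w

theorem norm_axial_le (hQ : Q ∈ SO3) (hlt : attNorm Q < 1) : ‖axial Q‖ ≤ 2 * attNorm Q := by
  obtain ⟨η, ε, h1, hn, hq⟩ := exists_quaternion hQ hlt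
  refine abs_le_of_sq_le_sq' ?_ (by linarith [attNorm_nonneg Q]) |>.2
  rw [norm_axial_of_quaternion hq, hn]
  nlinarith [mul_nonneg (sq_nonneg ‖ε‖) (sq_nonneg ‖ε‖)]

theorem norm_axial_le_one (hQ : Q ∈ SO3) (hlt : attNorm Q < 1) : ‖axial Q‖ ≤ 1 := by
  obtain ⟨η, ε, h1, hn, hq⟩ := exists_quaternion hQ hlt
  refine abs_le_of_sq_le_sq' ?_ zero_le_one |>.2
  rw [norm_axial_of_quaternion hq]
  nlinarith [sq_nonneg (η ^ 2 - ‖ε‖ ^ 2)]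

theorem inner_sub_act_add_le (hQ : Q ∈ SO3) (hlt : attNorm Q < 1) (w z : Vec3) :
    inner ℝ w (z - act Q z) + inner ℝ z (w - act Q w) ≤ 4 * attNorm Q ^ 2 * ‖w‖ * ‖z‖ := by
  obtain ⟨η, ε, h1, hn, hq⟩ := exists_quaternion hQ hlt
  rw [inner_sub_act_add_of_quaternion hq, hn]
  have h := real_inner_le_norm (cross w ε) (cross z ε)
  have h2 := mul_le_mul (norm_cross_le w ε) (norm_cross_le z ε) (norm_nonneg _) (by positivity)
  linarith

theorem le_inner_axial_innovation (hQ : Q ∈ SO3) (hlt : attNorm Q < 1)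
    (hl : IsCoercivePair ρ₁ ρ₂ l m a) :
    4 * (1 - attNorm Q ^ 2) * (l * attNorm Q ^ 2) ≤
      inner ℝ (axial Q) (innovation ρ₁ ρ₂ m a Q) := by
  obtain ⟨η, ε, h1, hn, hq⟩ := exists_quaternion hQ hlt
  rw [innovation, inner_add_right, inner_smul_right, inner_smul_right,
    inner_axial_cross_act_of_quaternion hq, inner_axial_cross_act_of_quaternion hq, hn]
  have h := mul_le_mul_of_nonneg_left (hl ε) (by positivity : 0 ≤ 4 * η ^ 2)
  have h2 : 1 - ‖ε‖ ^ 2 = η ^ 2 := by linarith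
  rw [h2]
  linarith

/-- The innovation vanishes on `{|Q|_I < 1}` only at the identity. -/
theorem le_norm_innovation_sq (hQ : Q ∈ SO3) (hlt : attNorm Q < 1) (hl0 : 0 ≤ l)
    (hl : IsCoercivePair ρ₁ ρ₂ l m a) :
    4 * (1 - attNorm Q ^ 2) * l ^ 2 * attNorm Q ^ 2 ≤ ‖innovation ρ₁ ρ₂ m a Q‖ ^ 2 := by
  have h := le_inner_axial_innovation hQ hlt hl
  obtain ⟨η, ε, h1, hn, hq⟩ := exists_quaternion hQ hlt
  have h2 : 1 - ‖ε‖ ^ 2 = η ^ 2 := by linarith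
  have h3 := h.trans (real_inner_le_norm _ _)
  rw [hn, h2] at h3 ⊢
  have h4 := pow_le_pow_left₀ (by positivity) h3 2
  rw [mul_pow ‖axial Q‖, norm_axial_of_quaternion hq] at h4
  rcases (by positivity : 0 ≤ 4 * η ^ 2 * ‖ε‖ ^ 2).eq_or_lt with h0 | h0
  · have : 4 * η ^ 2 * l ^ 2 * ‖ε‖ ^ 2 = l ^ 2 * (4 * η ^ 2 * ‖ε‖ ^ 2) := by ring
    rw [this, ← h0, mul_zero]
    positivity
  · refine le_of_mul_le_mul_left ?_ h0
    linarith

theorem norm_innovation_le (hρ₁ : 0 ≤ ρ₁) (hρ₂ : 0 ≤ ρ₂) (hQ : Q ∈ SO3) (hlt : attNorm Q < 1) :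
    ‖innovation ρ₁ ρ₂ m a Q‖ ≤ 2 * (ρ₁ * ‖m‖ ^ 2 + ρ₂ * ‖a‖ ^ 2) * attNorm Q := by
  have key (w : Vec3) : ‖cross w (act Q w)‖ ≤ ‖w‖ * (2 * attNorm Q * ‖w‖) := by
    have : cross w (act Q w) = cross w (act Q w - w) := by
      rw [cross_sub_right]; simp [cross]
    rw [this]
    exact (norm_cross_le _ _).trans
      (mul_le_mul_of_nonneg_left (norm_act_sub_self_le hQ hlt w) (norm_nonneg _))
  refine (norm_add_le _ _).trans ?_
  rw [norm_smul, norm_smul, Real.norm_of_nonneg hρ₁, Real.norm_of_nonneg hρ₂]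
  have h1 := mul_le_mul_of_nonneg_left (key m) hρ₁
  have h2 := mul_le_mul_of_nonneg_left (key a) hρ₂
  linarith

theorem potential_of_quaternion {η : ℝ} {ε : Vec3}
    (hq : Q = 1 + (2 * η) • skew ε + (2 : ℝ) • (skew ε * skew ε)) :
    potential ρ₁ ρ₂ m a Q = ρ₁ * ‖cross m ε‖ ^ 2 + ρ₂ * ‖cross a ε‖ ^ 2 := by
  have hm := inner_sub_act_add_of_quaternion hq m m
  have ha := inner_sub_act_add_of_quaternion hq a a
  rw [real_inner_self_eq_norm_sq] at hm ha
  rw [potential]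
  linear_combination ρ₁ / 4 * hm + ρ₂ / 4 * ha

theorem le_potential (hQ : Q ∈ SO3) (hlt : attNorm Q < 1) (hl : IsCoercivePair ρ₁ ρ₂ l m a) :
    l * attNorm Q ^ 2 ≤ potential ρ₁ ρ₂ m a Q := by
  obtain ⟨η, ε, -, hn, hq⟩ := exists_quaternion hQ hlt
  rw [potential_of_quaternion hq, hn]
  exact hl ε

theorem potential_le (hρ₁ : 0 ≤ ρ₁) (hρ₂ : 0 ≤ ρ₂) (hQ : Q ∈ SO3) (hlt : attNorm Q < 1) :
    potential ρ₁ ρ₂ m a Q ≤ (ρ₁ * ‖m‖ ^ 2 + ρ₂ * ‖a‖ ^ 2) * attNorm Q ^ 2 := by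
  obtain ⟨η, ε, -, hn, hq⟩ := exists_quaternion hQ hlt
  rw [potential_of_quaternion hq, hn]
  have h1 := pow_le_pow_left₀ (norm_nonneg _) (norm_cross_le m ε) 2
  have h2 := pow_le_pow_left₀ (norm_nonneg _) (norm_cross_le a ε) 2
  rw [mul_pow] at h1 h2
  have h3 := mul_le_mul_of_nonneg_left h1 hρ₁
  have h4 := mul_le_mul_of_nonneg_left h2 hρ₂
  linarith

/-- The derivative of `Q ↦ axial Q ⬝ w` along `Q' = -[u]ₓ Q` is `-u ⬝ w` up to an error
proportional to the distance of `Q` to the identity. -/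
theorem inner_axial_neg_skew_mul_le (hQ : Q ∈ SO3) (hlt : attNorm Q < 1) (u w : Vec3) :
    inner ℝ (axial (-(skew u * Q))) w ≤ -inner ℝ u w + 3 * attNorm Q * (‖u‖ * ‖w‖) := by
  have hneg : axial (-(skew u * Q)) = -axial (skew u * Q) := by
    refine vec3_ext ?_ ?_ ?_ <;>
      simp only [PiLp.neg_apply, axial_zero, axial_one, axial_two, Matrix.neg_apply] <;> ring
  have e1 : (inner ℝ (axial (-(skew u * Q))) w : ℝ) =
      -inner ℝ u w + 2 * attNorm Q ^ 2 * inner ℝ u w + inner ℝ (act Q u - u) w / 2 := by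
    rw [hneg, inner_neg_left, inner_axial_skew_mul, trace_of_mem_SO3 hQ, inner_sub_left]
    ring
  have h0 := attNorm_nonneg Q
  have h1 : attNorm Q ^ 2 * inner ℝ u w ≤ attNorm Q ^ 2 * (‖u‖ * ‖w‖) :=
    mul_le_mul_of_nonneg_left (real_inner_le_norm _ _) (sq_nonneg _)
  have h2 : (inner ℝ (act Q u - u) w : ℝ) ≤ 2 * attNorm Q * ‖u‖ * ‖w‖ :=
    (real_inner_le_norm _ _).trans
      (mul_le_mul_of_nonneg_right (norm_act_sub_self_le hQ hlt u) (norm_nonneg _))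
  have h3 : attNorm Q ^ 2 * (‖u‖ * ‖w‖) ≤ attNorm Q * (‖u‖ * ‖w‖) :=
    mul_le_mul_of_nonneg_right (by nlinarith) (by positivity)
  rw [e1]
  linarith

end Estimates

/-! ### Calculus for vector and matrix signals -/

section Calculus

variable {t a b : ℝ}

theorem hasDerivAt_vec3 {f : ℝ → Vec3} {f' : Vec3} :
    HasDerivAt f f' t ↔ ∀ i, HasDerivAt (fun s => f s i) (f' i) t := by
  simp only [← hasDerivWithinAt_univ, hasDerivWithinAt_iff_hasFDerivWithinAt]
  rw [hasFDerivWithinAt_euclidean]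
  rfl

theorem HasDerivAt.act {M : ℝ → Mat3} {M' : Mat3} {f : ℝ → Vec3} {f' : Vec3}
    (hM : ∀ i j, HasDerivAt (fun s => M s i j) (M' i j) t) (hf : HasDerivAt f f' t) :
    HasDerivAt (fun s => act (M s) (f s)) (act M' (f t) + act (M t) f') t := by
  rw [hasDerivAt_vec3] at hf ⊢
  intro i
  simp only [act_apply, PiLp.add_apply]
  refine ((((hM i 0).mul (hf 0)).add ((hM i 1).mul (hf 1))).add
    ((hM i 2).mul (hf 2))).congr_deriv ?_
  ring

theorem HasDerivAt.axial {M : ℝ → Mat3} {M' : Mat3}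
    (hM : ∀ i j, HasDerivAt (fun s => M s i j) (M' i j) t) :
    HasDerivAt (fun s => axial (M s)) (axial M') t := by
  rw [hasDerivAt_vec3]
  intro i
  fin_cases i
  · simpa only [Fin.zero_eta, axial_zero] using ((hM 2 1).fun_sub (hM 1 2)).div_const 2
  · simpa only [Fin.mk_one, axial_one] using ((hM 0 2).fun_sub (hM 2 0)).div_const 2
  · simpa only [Fin.reduceFinMk, axial_two] using ((hM 1 0).fun_sub (hM 0 1)).div_const 2

theorem HasDerivAt.trace {M : ℝ → Mat3} {M' : Mat3}
    (hM : ∀ i j, HasDerivAt (fun s => M s i j) (M' i j) t) :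
    HasDerivAt (fun s => (M s).trace) M'.trace t := by
  simp only [Matrix.trace_fin_three]
  exact ((hM 0 0).add (hM 1 1)).add (hM 2 2)

theorem HasDerivAt.mat3_mul {M N : ℝ → Mat3} {M' N' : Mat3}
    (hM : ∀ i j, HasDerivAt (fun s => M s i j) (M' i j) t)
    (hN : ∀ i j, HasDerivAt (fun s => N s i j) (N' i j) t) (i j : Fin 3) :
    HasDerivAt (fun s => (M s * N s) i j) ((M' * N t + M t * N') i j) t := by
  simp only [Matrix.mul_apply, Fin.sum_univ_three, Matrix.add_apply]
  refine ((((hM i 0).mul (hN 0 j)).add ((hM i 1).mul (hN 1 j))).add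
    ((hM i 2).mul (hN 2 j))).congr_deriv ?_
  ring

theorem AbsolutelyContinuousOnInterval.vec3_apply {f : ℝ → Vec3}
    (hf : AbsolutelyContinuousOnInterval f a b) (i : Fin 3) :
    AbsolutelyContinuousOnInterval (fun s => f s i) a b :=
  (EuclideanSpace.proj (𝕜 := ℝ) i :
    Vec3 →L[ℝ] ℝ).lipschitz.comp_absolutelyContinuousOnInterval hf

theorem AbsolutelyContinuousOnInterval.vec3_of_apply {f : ℝ → Vec3}
    (hf : ∀ i, AbsolutelyContinuousOnInterval (fun s => f s i) a b) :
    AbsolutelyContinuousOnInterval f a b := by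
  have h : f = fun s => f s 0 • EuclideanSpace.single (0 : Fin 3) (1 : ℝ) +
      f s 1 • EuclideanSpace.single (1 : Fin 3) (1 : ℝ) +
      f s 2 • EuclideanSpace.single (2 : Fin 3) (1 : ℝ) := by
    funext s
    refine vec3_ext ?_ ?_ ?_ <;> simp
  rw [h]
  have c (i : Fin 3) : AbsolutelyContinuousOnInterval
      (fun s => f s i • EuclideanSpace.single i (1 : ℝ)) a b :=
    (hf i).fun_smul (absolutelyContinuousOnInterval_const _)
  exact ((c 0).fun_add (c 1)).fun_add (c 2)

theorem AbsolutelyContinuousOnInterval.inner {f g : ℝ → Vec3}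
    (hf : AbsolutelyContinuousOnInterval f a b) (hg : AbsolutelyContinuousOnInterval g a b) :
    AbsolutelyContinuousOnInterval (fun s => (Inner.inner ℝ (f s) (g s) : ℝ)) a b := by
  simp only [inner_vec3]
  exact (((hf.vec3_apply 0).fun_mul (hg.vec3_apply 0)).fun_add
    ((hf.vec3_apply 1).fun_mul (hg.vec3_apply 1))).fun_add
    ((hf.vec3_apply 2).fun_mul (hg.vec3_apply 2))

theorem AbsolutelyContinuousOnInterval.vec3_norm_sq {f : ℝ → Vec3}
    (hf : AbsolutelyContinuousOnInterval f a b) :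
    AbsolutelyContinuousOnInterval (fun s => ‖f s‖ ^ 2) a b := by
  simpa only [real_inner_self_eq_norm_sq] using hf.inner hf

theorem AbsolutelyContinuousOnInterval.act {M : ℝ → Mat3} {f : ℝ → Vec3}
    (hM : ∀ i j, AbsolutelyContinuousOnInterval (fun s => M s i j) a b)
    (hf : AbsolutelyContinuousOnInterval f a b) :
    AbsolutelyContinuousOnInterval (fun s => act (M s) (f s)) a b := by
  refine .vec3_of_apply fun i => ?_
  simp only [act_apply]
  exact (((hM i 0).fun_mul (hf.vec3_apply 0)).fun_add
    ((hM i 1).fun_mul (hf.vec3_apply 1))).fun_add ((hM i 2).fun_mul (hf.vec3_apply 2))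

theorem AbsolutelyContinuousOnInterval.cross {f g : ℝ → Vec3}
    (hf : AbsolutelyContinuousOnInterval f a b) (hg : AbsolutelyContinuousOnInterval g a b) :
    AbsolutelyContinuousOnInterval (fun s => cross (f s) (g s)) a b := by
  refine .vec3_of_apply fun i => ?_
  fin_cases i
  · simpa only [Fin.zero_eta, cross_zero] using
      ((hf.vec3_apply 1).fun_mul (hg.vec3_apply 2)).fun_sub
        ((hf.vec3_apply 2).fun_mul (hg.vec3_apply 1))
  · simpa only [Fin.mk_one, cross_one] using
      ((hf.vec3_apply 2).fun_mul (hg.vec3_apply 0)).fun_sub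
        ((hf.vec3_apply 0).fun_mul (hg.vec3_apply 2))
  · simpa only [Fin.reduceFinMk, cross_two] using
      ((hf.vec3_apply 0).fun_mul (hg.vec3_apply 1)).fun_sub
        ((hf.vec3_apply 1).fun_mul (hg.vec3_apply 0))

theorem AbsolutelyContinuousOnInterval.axial {M : ℝ → Mat3}
    (hM : ∀ i j, AbsolutelyContinuousOnInterval (fun s => M s i j) a b) :
    AbsolutelyContinuousOnInterval (fun s => axial (M s)) a b := by
  have h (i j k l : Fin 3) :
      AbsolutelyContinuousOnInterval (fun s => (M s i j - M s k l) / 2) a b := by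
    simp only [div_eq_inv_mul]
    exact ((hM i j).fun_sub (hM k l)).const_mul _
  refine .vec3_of_apply fun i => ?_
  fin_cases i
  · simpa only [Fin.zero_eta, axial_zero] using h 2 1 1 2
  · simpa only [Fin.mk_one, axial_one] using h 0 2 2 0
  · simpa only [Fin.reduceFinMk, axial_two] using h 1 0 0 1

theorem AbsolutelyContinuousOnInterval.trace {M : ℝ → Mat3}
    (hM : ∀ i j, AbsolutelyContinuousOnInterval (fun s => M s i j) a b) :
    AbsolutelyContinuousOnInterval (fun s => (M s).trace) a b := by
  simp only [Matrix.trace_fin_three]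
  exact ((hM 0 0).fun_add (hM 1 1)).fun_add (hM 2 2)

theorem AbsolutelyContinuousOnInterval.mat3_mul {M N : ℝ → Mat3}
    (hM : ∀ i j, AbsolutelyContinuousOnInterval (fun s => M s i j) a b)
    (hN : ∀ i j, AbsolutelyContinuousOnInterval (fun s => N s i j) a b) (i j : Fin 3) :
    AbsolutelyContinuousOnInterval (fun s => (M s * N s) i j) a b := by
  simp only [Matrix.mul_apply, Fin.sum_univ_three]
  exact (((hM i 0).fun_mul (hN 0 j)).fun_add ((hM i 1).fun_mul (hN 1 j))).fun_add
    ((hM i 2).fun_mul (hN 2 j))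

end Calculus

/-! ### The error system in the inertial frame -/

/-- The innovation term of the observer, expressed in the inertial frame, when the estimate of the
acceleration `a` is off by `r`. -/
def perturbedInnovation (ρ₁ ρ₂ : ℝ) (m a r : Vec3) (Q : Mat3) : Vec3 :=
  innovation ρ₁ ρ₂ m a Q - ρ₂ • cross a (act Q r)

/-- The closed-loop error dynamics on `[t₀, T]` in the inertial frame: `Q` is the attitude error,
`β` the gyro-bias error, `r` the acceleration error and `a` the apparent acceleration. The bias
error is rotated to the inertial frame, which produces the rotation rate `w` in its equation, and
`d` is the contribution of the parameter projection. -/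
structure IsErrorSystem (q : ObserverParams) (l c₂ c₃ c₄ c₅ t₀ T : ℝ)
    (Q : ℝ → Mat3) (β r a : ℝ → Vec3) : Prop where
  mem_SO3 : ∀ t ∈ Icc t₀ T, Q t ∈ SO3
  norm_bias_le : ∀ t ∈ Icc t₀ T, ‖β t‖ ≤ 2 * c₅
  norm_accel_le : ∀ t ∈ Icc t₀ T, ‖a t‖ ≤ c₂
  coercive : ∀ t ∈ Icc t₀ T, IsCoercivePair q.ρ₁ q.ρ₂ l q.rm (a t)
  ac_att : ∀ i j, AbsolutelyContinuousOnInterval (fun t => Q t i j) t₀ T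
  ac_bias : AbsolutelyContinuousOnInterval β t₀ T
  ac_err : AbsolutelyContinuousOnInterval r t₀ T
  ac_accel : AbsolutelyContinuousOnInterval a t₀ T
  ode : ∀ᵐ t ∂(volume : Measure ℝ), t ∈ Icc t₀ T → ∃ s w d a' : Vec3,
    s = perturbedInnovation q.ρ₁ q.ρ₂ q.rm (a t) (r t) (Q t) ∧
    ‖w‖ ≤ c₄ ∧ ‖d‖ ≤ q.kb * ‖s‖ ∧ inner ℝ (β t) d ≤ q.kb * inner ℝ (β t) s ∧ ‖a'‖ ≤ c₃ ∧
    (∀ i j, HasDerivAt (fun τ => Q τ i j) ((-(skew (β t + q.kR • s) * Q t)) i j) t) ∧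
    HasDerivAt β (cross w (β t) + d) t ∧
    HasDerivAt r (-q.kv • r t + (a' - act (Q t)ᵀ a') - act (Q t)ᵀ (cross (β t) (a t))) t ∧
    HasDerivAt a a' t

section Pointwise

variable {Q : Mat3} {a a' β r : Vec3} {c₂ c₃ c₄ : ℝ}

/-- The linear damping `kv` dominates the acceleration error, up to terms driven by the attitude
and bias errors. -/
theorem inner_accel_error_rate_le (hQ : Q ∈ SO3) (hlt : attNorm Q < 1) (kv : ℝ)
    (ha : ‖a‖ ≤ c₂) (ha' : ‖a'‖ ≤ c₃) :
    inner ℝ r (-kv • r + (a' - act Qᵀ a') - act Qᵀ (cross β a)) ≤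
      -kv * ‖r‖ ^ 2 + ‖r‖ * (2 * c₃ * attNorm Q + c₂ * ‖β‖) := by
  rw [inner_sub_right, inner_add_right, inner_smul_right, real_inner_self_eq_norm_sq]
  have h1 := real_inner_le_norm r (a' - act Qᵀ a')
  have h2 := neg_le_of_abs_le (abs_real_inner_le_norm r (act Qᵀ (cross β a)))
  rw [norm_act (transpose_mem_SO3 hQ)] at h2
  have h3 : ‖a' - act Qᵀ a'‖ ≤ 2 * c₃ * attNorm Q := by
    refine (norm_sub_act_transpose_le hQ hlt a').trans ?_
    nlinarith [attNorm_nonneg Q]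
  have h4 : ‖cross β a‖ ≤ c₂ * ‖β‖ := by
    refine (norm_cross_le β a).trans ?_
    nlinarith [norm_nonneg β]
  have h5 := mul_le_mul_of_nonneg_left h3 (norm_nonneg r)
  have h6 := mul_le_mul_of_nonneg_left h4 (norm_nonneg r)
  linarith

theorem norm_cross_act_le (hQ : Q ∈ SO3) (ha : ‖a‖ ≤ c₂) : ‖cross a (act Q r)‖ ≤ c₂ * ‖r‖ := by
  refine (norm_cross_le _ _).trans ?_
  rw [norm_act hQ]
  exact mul_le_mul_of_nonneg_right ha (norm_nonneg _)

theorem norm_perturbedInnovation_le {ρ₁ ρ₂ M : ℝ} {m : Vec3} (hρ₁ : 0 ≤ ρ₁) (hρ₂ : 0 ≤ ρ₂)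
    (hQ : Q ∈ SO3) (hlt : attNorm Q < 1) (ha : ‖a‖ ≤ c₂)
    (hM : ρ₁ * ‖m‖ ^ 2 + ρ₂ * ‖a‖ ^ 2 ≤ M) :
    ‖perturbedInnovation ρ₁ ρ₂ m a r Q‖ ≤ 2 * M * attNorm Q + ρ₂ * c₂ * ‖r‖ := by
  refine (norm_sub_le _ _).trans (add_le_add ?_ ?_)
  · refine (norm_innovation_le hρ₁ hρ₂ hQ hlt).trans ?_
    exact mul_le_mul_of_nonneg_right (by linarith) (attNorm_nonneg Q)
  · rw [norm_smul, Real.norm_of_nonneg hρ₂, mul_assoc]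
    exact mul_le_mul_of_nonneg_left (norm_cross_act_le hQ ha) hρ₂

/-- Rate of the squared attitude error along the error dynamics. -/
theorem attitude_error_rate_le {ρ₁ ρ₂ l kR : ℝ} {m : Vec3} (hρ₂ : 0 ≤ ρ₂) (hkR : 0 ≤ kR)
    (hQ : Q ∈ SO3) (hlt : attNorm Q < 1) (ha : ‖a‖ ≤ c₂) (hl : IsCoercivePair ρ₁ ρ₂ l m a) :
    -inner ℝ (β + kR • perturbedInnovation ρ₁ ρ₂ m a r Q) (axial Q) / 2 ≤
      ‖β‖ / 2 - 2 * kR * l * (1 - attNorm Q ^ 2) * attNorm Q ^ 2 +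
        kR * ρ₂ * c₂ / 2 * ‖r‖ := by
  have h0 := norm_axial_le_one hQ hlt
  have h1 : -‖β‖ ≤ inner ℝ β (axial Q) := by
    refine le_trans ?_ (neg_le_of_abs_le (abs_real_inner_le_norm β (axial Q)))
    nlinarith [norm_nonneg β]
  have h2 := le_inner_axial_innovation hQ hlt hl
  have h3 : (inner ℝ (cross a (act Q r)) (axial Q) : ℝ) ≤ c₂ * ‖r‖ := by
    refine (real_inner_le_norm _ _).trans ?_
    exact (mul_le_of_le_one_right (norm_nonneg _) h0).trans (norm_cross_act_le hQ ha)
  rw [real_inner_comm] at h2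
  have h4 := mul_le_mul_of_nonneg_left h2 hkR
  have h5 := mul_le_mul_of_nonneg_left h3 (mul_nonneg hkR hρ₂)
  rw [perturbedInnovation, inner_add_left, inner_smul_left, inner_sub_left, inner_smul_left]
  simp only [conj_trivial]
  linarith

end Pointwise

namespace IsErrorSystem

variable {q : ObserverParams} {l c₂ c₃ c₄ c₅ t₀ T : ℝ} {Q : ℝ → Mat3} {β r a : ℝ → Vec3}

/-- The attitude error never approaches the critical set `|Q|_I = 1`: on the set `U ≤ u < 1`, where
`U = |Q|_I² + p ‖r‖²`, the attitude gain absorbs the bias error, and the velocity gain absorbs the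
acceleration error. -/
theorem attNorm_sq_le (S : IsErrorSystem q l c₂ c₃ c₄ c₅ t₀ T Q β r a)
    (hρ₂ : 0 ≤ q.ρ₂) (hkR : 0 ≤ q.kR) (hc₂ : 0 ≤ c₂) (hc₃ : 0 ≤ c₃) (hl : 0 ≤ l)
    {p κ u : ℝ} (hp : 0 < p) (hκ : 0 < κ) (hu : u < 1) (hκu : κ ≤ 2 * q.kR * l * (1 - u))
    (hkv : (q.kR * q.ρ₂ * c₂ / 2 + 2 * p * (2 * c₃ + 2 * c₅ * c₂)) ^ 2 ≤ p * (2 * q.kv - κ))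
    (hD : (c₅ + 1) / κ < u) (h₀ : attNorm (Q t₀) ^ 2 + p * ‖r t₀‖ ^ 2 < u) :
    ∀ t ∈ Icc t₀ T, attNorm (Q t) ^ 2 ≤ u := by
  have hU (t) (ht : t ∈ Icc t₀ T) : (3 - (Q t).trace) / 4 = attNorm (Q t) ^ 2 := by
    rw [trace_of_mem_SO3 (S.mem_SO3 t ht)]; ring
  have hac : AbsolutelyContinuousOnInterval
      (fun t => (3 - (Q t).trace) / 4 + p * ‖r t‖ ^ 2) t₀ T := by
    simp only [div_eq_inv_mul]
    exact (((absolutelyContinuousOnInterval_const _).fun_sub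
      (AbsolutelyContinuousOnInterval.trace S.ac_att)).const_mul _).fun_add
      (S.ac_err.vec3_norm_sq.const_mul p)
  intro t ht
  have h₀' : (3 - (Q t₀).trace) / 4 + p * ‖r t₀‖ ^ 2 < u := by
    rwa [hU t₀ (left_mem_Icc.2 (ht.1.trans ht.2))]
  have main := hac.le_of_ae_deriv_le_on_sublevel hκ h₀' hD (by
    filter_upwards [S.ode] with t hode ht hle
    obtain ⟨s, w, d, a', rfl, -, -, -, ha', hdQ, -, hdr, -⟩ := hode ht
    have hQ := S.mem_SO3 t ht
    have ha := S.norm_accel_le t ht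
    have hb := S.norm_bias_le t ht
    rw [hU t ht] at hle
    have hyu : attNorm (Q t) ^ 2 ≤ u := by nlinarith [sq_nonneg ‖r t‖]
    have hy0 := attNorm_nonneg (Q t)
    have hlt : attNorm (Q t) < 1 := by nlinarith
    refine ⟨_, (((HasDerivAt.trace hdQ).const_sub 3).div_const 4).add
      (hdr.norm_sq.const_mul p), ?_⟩
    rw [Matrix.trace_neg, trace_skew_mul, hU t ht]
    have h1 := attitude_error_rate_le (β := β t) (r := r t) hρ₂ hkR hQ hlt ha (S.coercive t ht)
    have h2 := inner_accel_error_rate_le (β := β t) (r := r t) hQ hlt q.kv ha ha'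
    have h3 : ‖r t‖ * (2 * c₃ * attNorm (Q t) + c₂ * ‖β t‖) ≤
        ‖r t‖ * (2 * c₃ + 2 * c₅ * c₂) := by
      refine mul_le_mul_of_nonneg_left ?_ (norm_nonneg _)
      nlinarith
    have h4 : κ * attNorm (Q t) ^ 2 ≤
        2 * q.kR * l * (1 - attNorm (Q t) ^ 2) * attNorm (Q t) ^ 2 := by
      refine mul_le_mul_of_nonneg_right (hκu.trans ?_) (sq_nonneg _)
      exact mul_le_mul_of_nonneg_left (by linarith) (by positivity)
    have h5 := mul_le_mul_of_nonneg_left (h2.trans (add_le_add_right h3 _))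
      (by positivity : 0 ≤ 2 * p)
    have h6 := mul_le_mul_of_nonneg_right hkv (sq_nonneg ‖r t‖)
    nlinarith [sq_nonneg ((q.kR * q.ρ₂ * c₂ / 2 + 2 * p * (2 * c₃ + 2 * c₅ * c₂)) * ‖r t‖ - 1)])
    t ht
  rw [hU t ht] at main
  nlinarith [sq_nonneg ‖r t‖]

end IsErrorSystem

/-! ### The strict Lyapunov function -/

/-- Along `Q' = -[u]ₓ Q` the potential decreases at the rate `u ⬝ innovation / 2`, up to the drift
of the direction `a`. -/
theorem hasDerivAt_potential {ρ₁ ρ₂ t : ℝ} {m u a' : Vec3} {a : ℝ → Vec3} {Q : ℝ → Mat3}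
    (hQ : ∀ i j, HasDerivAt (fun τ => Q τ i j) ((-(skew u * Q t)) i j) t)
    (ha : HasDerivAt a a' t) :
    HasDerivAt (fun τ => potential ρ₁ ρ₂ m (a τ) (Q τ))
      (-inner ℝ u (innovation ρ₁ ρ₂ m (a t) (Q t)) / 2 +
        ρ₂ / 2 * (inner ℝ a' (a t - act (Q t) (a t)) + inner ℝ (a t) (a' - act (Q t) a'))) t := by
  have hN (w : Vec3) : act (-(skew u * Q t)) w = -cross u (act (Q t) w) := by
    rw [← act_skew, ← act_mul]; simp [act, Matrix.neg_mulVec]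
  have hm : HasDerivAt (fun _ : ℝ => m) 0 t := hasDerivAt_const t m
  have key (w : Vec3) : (inner ℝ w (cross u (act (Q t) w)) : ℝ) =
      -inner ℝ u (cross w (act (Q t) w)) := by
    simp only [inner_vec3, cross_zero, cross_one, cross_two]; ring
  refine ((((hm.inner ℝ (hm.sub (HasDerivAt.act hQ hm))).const_mul ρ₁).add
    ((ha.inner ℝ (ha.sub (HasDerivAt.act hQ ha))).const_mul ρ₂)).div_const 2).congr_deriv ?_
  have hz : act (Q t) 0 = 0 := by simp [act]
  simp only [hN, hz, innovation, inner_sub_right, inner_add_right, inner_neg_right,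
    inner_smul_right, key, inner_zero_left, inner_zero_right, Pi.sub_apply]
  ring

/-- The Lyapunov function of the error system: the attitude potential and the bias energy, weighted
so that their mutual coupling cancels, plus a small cross term between the attitude and bias errors
that produces damping in the bias direction, plus the energy of the acceleration error. -/
def lyapunov (q : ObserverParams) (δ : ℝ) (Q : Mat3) (β r a : Vec3) : ℝ :=
  potential q.ρ₁ q.ρ₂ q.rm a Q + ‖β‖ ^ 2 / (4 * q.kb) + δ * inner ℝ (axial Q) β + ‖r‖ ^ 2

/-- An upper bound for the rate of the Lyapunov function in terms of the norms `y`, `b` and `r` of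
the attitude, bias and acceleration errors, on `{|Q|_I² ≤ u}`. The constant `M` bounds
`ρ₁ ‖m‖² + ρ₂ ‖a‖²`. -/
def rateBound (q : ObserverParams) (l M c₂ c₃ c₄ c₅ u δ y b r : ℝ) : ℝ :=
  -2 * q.kR * (1 - u) * l ^ 2 * y ^ 2 + q.kR * q.ρ₂ * c₂ * M * y * r +
    2 * q.ρ₂ * c₂ * c₃ * y ^ 2 + q.ρ₂ * c₂ / 2 * b * r +
    δ * (-b ^ 2 + 6 * c₅ * y * b + 4 * q.kR * (2 * M * y + q.ρ₂ * c₂ * r) * b + 2 * c₄ * y * b +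
      2 * q.kb * y * (2 * M * y + q.ρ₂ * c₂ * r)) +
    2 * (-q.kv * r ^ 2 + r * (2 * c₃ * y + c₂ * b))

section Rates

variable {q : ObserverParams} {l M c₂ c₃ c₄ c₅ u : ℝ} {Q : Mat3} {β r a a' w d s : Vec3}

/-- The attitude and bias parts of the Lyapunov rate: the products of the innovation with the bias
error cancel, and the square of the innovation remains. -/
theorem potential_add_bias_rate_le (hρ₁ : 0 ≤ q.ρ₁) (hρ₂ : 0 ≤ q.ρ₂) (hkb : 0 < q.kb)
    (hkR : 0 ≤ q.kR) (hl0 : 0 ≤ l) (hc₂ : 0 ≤ c₂) (hQ : Q ∈ SO3) (hlt : attNorm Q < 1)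
    (hu : attNorm Q ^ 2 ≤ u) (ha : ‖a‖ ≤ c₂) (ha' : ‖a'‖ ≤ c₃)
    (hl : IsCoercivePair q.ρ₁ q.ρ₂ l q.rm a) (hM : q.ρ₁ * ‖q.rm‖ ^ 2 + q.ρ₂ * ‖a‖ ^ 2 ≤ M)
    (hs : s = perturbedInnovation q.ρ₁ q.ρ₂ q.rm a r Q)
    (hd : inner ℝ β d ≤ q.kb * inner ℝ β s) :
    -inner ℝ (β + q.kR • s) (innovation q.ρ₁ q.ρ₂ q.rm a Q) / 2 +
        q.ρ₂ / 2 * (inner ℝ a' (a - act Q a) + inner ℝ a (a' - act Q a')) +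
        2 * inner ℝ β (cross w β + d) / (4 * q.kb) ≤
      -2 * q.kR * (1 - u) * l ^ 2 * attNorm Q ^ 2 + q.kR * q.ρ₂ * c₂ * M * attNorm Q * ‖r‖ +
        2 * q.ρ₂ * c₂ * c₃ * attNorm Q ^ 2 + q.ρ₂ * c₂ / 2 * ‖β‖ * ‖r‖ := by
  set I := innovation q.ρ₁ q.ρ₂ q.rm a Q with hI
  set g := cross a (act Q r) with hg
  have hs' : s = I - q.ρ₂ • g := hs
  have hy0 := attNorm_nonneg Q
  have hgn : ‖g‖ ≤ c₂ * ‖r‖ := norm_cross_act_le hQ ha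
  have h1 : 2 * inner ℝ β (cross w β + d) / (4 * q.kb) ≤ inner ℝ β s / 2 := by
    rw [inner_add_right, inner_cross_self_right, zero_add, div_le_iff₀ (by positivity)]
    linarith
  have h2 : -(inner ℝ β g : ℝ) ≤ c₂ * ‖β‖ * ‖r‖ := by
    refine (neg_le_abs _).trans ((abs_real_inner_le_norm β g).trans ?_)
    nlinarith [mul_le_mul_of_nonneg_left hgn (norm_nonneg β)]
  have h3 : (inner ℝ g I : ℝ) ≤ 2 * c₂ * M * attNorm Q * ‖r‖ := by
    refine (real_inner_le_norm g I).trans ?_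
    have hIn : ‖I‖ ≤ 2 * M * attNorm Q := (norm_innovation_le hρ₁ hρ₂ hQ hlt).trans
      (mul_le_mul_of_nonneg_right (by linarith) hy0)
    have := mul_le_mul hgn hIn (norm_nonneg _) (by positivity)
    linarith
  have h4 : 4 * (1 - u) * l ^ 2 * attNorm Q ^ 2 ≤ ‖I‖ ^ 2 := by
    refine le_trans ?_ (le_norm_innovation_sq hQ hlt hl0 hl)
    gcongr
  have h5 : inner ℝ a' (a - act Q a) + inner ℝ a (a' - act Q a') ≤
      4 * c₂ * c₃ * attNorm Q ^ 2 := by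
    refine (inner_sub_act_add_le hQ hlt a' a).trans ?_
    have := mul_le_mul ha' ha (norm_nonneg _) ((norm_nonneg _).trans ha')
    nlinarith [mul_le_mul_of_nonneg_left this (sq_nonneg (attNorm Q))]
  have e1 : (inner ℝ (β + q.kR • s) I : ℝ) =
      inner ℝ β I + q.kR * (‖I‖ ^ 2 - q.ρ₂ * inner ℝ g I) := by
    rw [hs', inner_add_left, inner_smul_left, inner_sub_left, inner_smul_left,
      real_inner_self_eq_norm_sq]
    simp only [conj_trivial]
  have e2 : (inner ℝ β s : ℝ) = inner ℝ β I - q.ρ₂ * inner ℝ β g := by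
    rw [hs', inner_sub_right, inner_smul_right]
  rw [e1]
  rw [e2] at h1
  have h2' := mul_le_mul_of_nonneg_left h2 hρ₂
  have h3' := mul_le_mul_of_nonneg_left h3 (mul_nonneg hkR hρ₂)
  have h4' := mul_le_mul_of_nonneg_left h4 hkR
  have h5' := mul_le_mul_of_nonneg_left h5 hρ₂
  linarith

/-- The rate of the cross term contains the damping `-‖β‖²`. The remaining angular part is
cubic in the errors, and it becomes quadratic because the bias error is bounded a priori. -/
theorem cross_term_rate_le (hρ₁ : 0 ≤ q.ρ₁) (hρ₂ : 0 ≤ q.ρ₂) (hkb : 0 ≤ q.kb)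
    (hkR : 0 ≤ q.kR) (hQ : Q ∈ SO3) (hlt : attNorm Q < 1)
    (ha : ‖a‖ ≤ c₂) (hM : q.ρ₁ * ‖q.rm‖ ^ 2 + q.ρ₂ * ‖a‖ ^ 2 ≤ M) (hβ : ‖β‖ ≤ 2 * c₅)
    (hs : s = perturbedInnovation q.ρ₁ q.ρ₂ q.rm a r Q)
    (hw : ‖w‖ ≤ c₄) (hd : ‖d‖ ≤ q.kb * ‖s‖) :
    inner ℝ (axial Q) (cross w β + d) + inner ℝ (axial (-(skew (β + q.kR • s) * Q))) β ≤
      -‖β‖ ^ 2 + 6 * c₅ * attNorm Q * ‖β‖ +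
        4 * q.kR * (2 * M * attNorm Q + q.ρ₂ * c₂ * ‖r‖) * ‖β‖ + 2 * c₄ * attNorm Q * ‖β‖ +
        2 * q.kb * attNorm Q * (2 * M * attNorm Q + q.ρ₂ * c₂ * ‖r‖) := by
  have hy0 := attNorm_nonneg Q
  have hb0 := norm_nonneg β
  have hsn : ‖s‖ ≤ 2 * M * attNorm Q + q.ρ₂ * c₂ * ‖r‖ :=
    hs ▸ norm_perturbedInnovation_le hρ₁ hρ₂ hQ hlt ha hM
  set N := 2 * M * attNorm Q + q.ρ₂ * c₂ * ‖r‖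
  have hax := norm_axial_le hQ hlt
  have h1 : (inner ℝ (axial Q) (cross w β) : ℝ) ≤ 2 * c₄ * attNorm Q * ‖β‖ := by
    have := mul_le_mul hax ((norm_cross_le w β).trans (mul_le_mul_of_nonneg_right hw hb0))
      (norm_nonneg _) (by positivity)
    linarith [real_inner_le_norm (axial Q) (cross w β)]
  have h2 : (inner ℝ (axial Q) d : ℝ) ≤ 2 * q.kb * attNorm Q * N := by
    have := mul_le_mul hax (hd.trans (mul_le_mul_of_nonneg_left hsn hkb)) (norm_nonneg _)
      (by positivity)
    linarith [real_inner_le_norm (axial Q) d]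
  have h3 := inner_axial_neg_skew_mul_le hQ hlt (β + q.kR • s) β
  have h4 : -(inner ℝ (β + q.kR • s) β : ℝ) ≤ -‖β‖ ^ 2 + q.kR * (N * ‖β‖) := by
    rw [inner_add_left, inner_smul_left, real_inner_self_eq_norm_sq, conj_trivial]
    have h : -(inner ℝ s β : ℝ) ≤ N * ‖β‖ :=
      (neg_le_abs _).trans ((abs_real_inner_le_norm s β).trans
        (mul_le_mul_of_nonneg_right hsn hb0))
    linarith [mul_le_mul_of_nonneg_left h hkR]
  have h5 : ‖β + q.kR • s‖ ≤ ‖β‖ + q.kR * N := by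
    refine (norm_add_le _ _).trans ?_
    rw [norm_smul, Real.norm_of_nonneg hkR]
    linarith [mul_le_mul_of_nonneg_left hsn hkR]
  have h6 : attNorm Q * (‖β + q.kR • s‖ * ‖β‖) ≤
      2 * c₅ * attNorm Q * ‖β‖ + q.kR * N * ‖β‖ := by
    have h7 : attNorm Q * (‖β‖ * ‖β‖) ≤ attNorm Q * (2 * c₅ * ‖β‖) := by gcongr
    have hN : 0 ≤ q.kR * N * ‖β‖ := by
      have := (norm_nonneg s).trans hsn
      positivity
    have h8 : attNorm Q * (q.kR * N * ‖β‖) ≤ q.kR * N * ‖β‖ :=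
      mul_le_of_le_one_left hN hlt.le
    calc attNorm Q * (‖β + q.kR • s‖ * ‖β‖)
        ≤ attNorm Q * ((‖β‖ + q.kR * N) * ‖β‖) := by gcongr
      _ ≤ _ := by linarith
  rw [inner_add_right]
  linarith

end Rates

namespace IsErrorSystem

variable {q : ObserverParams} {l M c₂ c₃ c₄ c₅ t₀ T : ℝ} {Q : ℝ → Mat3} {β r a : ℝ → Vec3}

theorem absolutelyContinuousOnInterval_lyapunov
    (S : IsErrorSystem q l c₂ c₃ c₄ c₅ t₀ T Q β r a) (δ : ℝ) :
    AbsolutelyContinuousOnInterval (fun t => lyapunov q δ (Q t) (β t) (r t) (a t)) t₀ T := by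
  have hrm := absolutelyContinuousOnInterval_const (a := t₀) (b := T) q.rm
  unfold lyapunov potential
  simp only [div_eq_inv_mul]
  exact (((((hrm.inner (hrm.fun_sub (.act S.ac_att hrm))).const_mul _).fun_add
    ((S.ac_accel.inner (S.ac_accel.fun_sub (.act S.ac_att S.ac_accel))).const_mul _)).const_mul
    _).fun_add (S.ac_bias.vec3_norm_sq.const_mul _)).fun_add
    (((AbsolutelyContinuousOnInterval.axial S.ac_att).inner S.ac_bias).const_mul _) |>.fun_add
    S.ac_err.vec3_norm_sq

theorem ae_hasDerivAt_lyapunov (S : IsErrorSystem q l c₂ c₃ c₄ c₅ t₀ T Q β r a)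
    (hρ₁ : 0 ≤ q.ρ₁) (hρ₂ : 0 ≤ q.ρ₂) (hkb : 0 < q.kb) (hkR : 0 ≤ q.kR) (hl : 0 ≤ l)
    (hc₂ : 0 ≤ c₂) (hM : q.ρ₁ * ‖q.rm‖ ^ 2 + q.ρ₂ * c₂ ^ 2 ≤ M) {u δ : ℝ} (hu : u < 1)
    (hδ : 0 ≤ δ) (hy : ∀ t ∈ Icc t₀ T, attNorm (Q t) ^ 2 ≤ u) :
    ∀ᵐ t ∂(volume : Measure ℝ), t ∈ Icc t₀ T →
      ∃ V', HasDerivAt (fun t => lyapunov q δ (Q t) (β t) (r t) (a t)) V' t ∧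
        V' ≤ rateBound q l M c₂ c₃ c₄ c₅ u δ (attNorm (Q t)) ‖β t‖ ‖r t‖ := by
  filter_upwards [S.ode] with t hode ht
  obtain ⟨s, w, d, a', hs, hw, hd, hβd, ha', hdQ, hdβ, hdr, hda⟩ := hode ht
  have hQ := S.mem_SO3 t ht
  have ha := S.norm_accel_le t ht
  have hyu := hy t ht
  have hlt : attNorm (Q t) < 1 := by nlinarith [attNorm_nonneg (Q t)]
  have hM' : q.ρ₁ * ‖q.rm‖ ^ 2 + q.ρ₂ * ‖a t‖ ^ 2 ≤ M := by
    refine le_trans ?_ hM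
    gcongr
  refine ⟨_, (((hasDerivAt_potential hdQ hda).add (hdβ.norm_sq.div_const (4 * q.kb))).add
    (((HasDerivAt.axial hdQ).inner ℝ hdβ).const_mul δ)).add hdr.norm_sq, ?_⟩
  have h1 := potential_add_bias_rate_le (w := w) hρ₁ hρ₂ hkb hkR hl hc₂ hQ hlt hyu ha ha'
    (S.coercive t ht) hM' hs hβd
  have h2 := cross_term_rate_le hρ₁ hρ₂ hkb.le hkR hQ hlt ha hM' (S.norm_bias_le t ht) hs hw hd
  have h3 := inner_accel_error_rate_le (β := β t) (r := r t) hQ hlt q.kv ha ha'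
  have h2' := mul_le_mul_of_nonneg_left h2 hδ
  unfold rateBound
  linarith

/-- Exponential decay of the error system, for a Lyapunov function that is equivalent to the squared
distance to the equilibrium and whose rate bound is negative definite. -/
theorem errDist_le (S : IsErrorSystem q l c₂ c₃ c₄ c₅ t₀ T Q β r a)
    (hρ₁ : 0 ≤ q.ρ₁) (hρ₂ : 0 ≤ q.ρ₂) (hkb : 0 < q.kb) (hkR : 0 ≤ q.kR) (hl : 0 ≤ l)
    (hc₂ : 0 ≤ c₂) (hM : q.ρ₁ * ‖q.rm‖ ^ 2 + q.ρ₂ * c₂ ^ 2 ≤ M) {u δ : ℝ} (hu : u < 1)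
    (hδ : 0 ≤ δ) (hδl : δ ^ 2 ≤ l / (16 * q.kb))
    {γ lo hi : ℝ} (hγ : 0 < γ) (hlo : 0 < lo) (hhi : 0 < hi) (hlo₁ : lo ≤ l / 2)
    (hlo₂ : lo ≤ 1 / (8 * q.kb)) (hlo₃ : lo ≤ 1)
    (hhi₁ : M + δ ≤ hi) (hhi₂ : 1 / (4 * q.kb) + δ ≤ hi) (hhi₃ : 1 ≤ hi)
    (hrate : ∀ y b r : ℝ, 0 ≤ y → 0 ≤ b → 0 ≤ r →
      rateBound q l M c₂ c₃ c₄ c₅ u δ y b r ≤ -γ * (y ^ 2 + b ^ 2 + r ^ 2))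
    (hy : ∀ t ∈ Icc t₀ T, attNorm (Q t) ^ 2 ≤ u) :
    ∀ t ∈ Icc t₀ T, √(attNorm (Q t) ^ 2 + ‖β t‖ ^ 2 + ‖r t‖ ^ 2) ≤
      √(hi / lo) * Real.exp (-(γ / (2 * hi)) * (t - t₀)) *
        √(attNorm (Q t₀) ^ 2 + ‖β t₀‖ ^ 2 + ‖r t₀‖ ^ 2) := by
  set V := fun t => lyapunov q δ (Q t) (β t) (r t) (a t) with hV
  set z := fun t => attNorm (Q t) ^ 2 + ‖β t‖ ^ 2 + ‖r t‖ ^ 2 with hz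
  have hz0 (t) : 0 ≤ z t := by positivity
  have hbounds (t) (ht : t ∈ Icc t₀ T) : lo * z t ≤ V t ∧ V t ≤ hi * z t := by
    have hQ := S.mem_SO3 t ht
    have ha := S.norm_accel_le t ht
    have hy0 := attNorm_nonneg (Q t)
    have hlt : attNorm (Q t) < 1 := by nlinarith [hy t ht]
    have hM' : q.ρ₁ * ‖q.rm‖ ^ 2 + q.ρ₂ * ‖a t‖ ^ 2 ≤ M := by
      refine le_trans ?_ hM
      gcongr
    have h1 := le_potential hQ hlt (S.coercive t ht)
    have h2 := (potential_le (m := q.rm) (a := a t) hρ₁ hρ₂ hQ hlt).trans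
      (mul_le_mul_of_nonneg_right hM' (sq_nonneg _))
    have hx : |inner ℝ (axial (Q t)) (β t)| ≤ 2 * attNorm (Q t) * ‖β t‖ :=
      (abs_real_inner_le_norm _ _).trans
        (mul_le_mul_of_nonneg_right (norm_axial_le hQ hlt) (norm_nonneg _))
    have hx1 := mul_le_mul_of_nonneg_left (neg_le_of_abs_le hx) hδ
    have hx2 := mul_le_mul_of_nonneg_left (le_of_abs_le hx) hδ
    have hsq := mul_nonneg hδ (sq_nonneg (attNorm (Q t) - ‖β t‖))
    simp only [hV, hz, lyapunov]
    constructor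
    · -- The cross term is at most half of the potential plus half of the bias energy.
      have hc : 2 * δ * (attNorm (Q t) * ‖β t‖) ≤
          l / 2 * attNorm (Q t) ^ 2 + 1 / (8 * q.kb) * ‖β t‖ ^ 2 := by
        have hA : 0 < l / 2 := hlo.trans_le hlo₁
        have e : l / (16 * q.kb) = l / 2 * (1 / (8 * q.kb)) := by
          rw [div_mul_div_comm]; ring
        rw [e] at hδl
        refine le_of_mul_le_mul_left ?_ hA
        nlinarith [sq_nonneg (l / 2 * attNorm (Q t) - δ * ‖β t‖),
          mul_le_mul_of_nonneg_right hδl (sq_nonneg ‖β t‖)]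
      have e : ‖β t‖ ^ 2 / (4 * q.kb) = 2 * (1 / (8 * q.kb) * ‖β t‖ ^ 2) := by
        ring
      have k1 := mul_le_mul_of_nonneg_right hlo₁ (sq_nonneg (attNorm (Q t)))
      have k2 := mul_le_mul_of_nonneg_right hlo₂ (sq_nonneg ‖β t‖)
      have k3 := mul_le_mul_of_nonneg_right hlo₃ (sq_nonneg ‖r t‖)
      linarith
    · have e : ‖β t‖ ^ 2 / (4 * q.kb) = 1 / (4 * q.kb) * ‖β t‖ ^ 2 := by ring
      have k1 := mul_le_mul_of_nonneg_right hhi₁ (sq_nonneg (attNorm (Q t)))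
      have k2 := mul_le_mul_of_nonneg_right hhi₂ (sq_nonneg ‖β t‖)
      have k3 := mul_le_mul_of_nonneg_right hhi₃ (sq_nonneg ‖r t‖)
      nlinarith
  intro t ht
  have ht₀ : t₀ ∈ Icc t₀ T := left_mem_Icc.2 (ht.1.trans ht.2)
  have hsub : Icc t₀ t ⊆ Icc t₀ T := Icc_subset_Icc_right ht.2
  have hdecay := ((S.absolutelyContinuousOnInterval_lyapunov δ).mono (c := t₀) (d := t) (by
    rwa [uIcc_of_le ht.1, uIcc_of_le (ht.1.trans ht.2)])).le_of_ae_deriv_le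
    (κ := γ / hi) (D := 0) (by positivity) ht.1 (by
      filter_upwards [S.ae_hasDerivAt_lyapunov hρ₁ hρ₂ hkb hkR hl hc₂ hM hu hδ hy] with τ hτ hmem
      obtain ⟨V', hd, hle⟩ := hτ (hsub hmem)
      refine ⟨V', hd, ?_⟩
      have h1 := hrate _ _ _ (attNorm_nonneg (Q τ)) (norm_nonneg (β τ)) (norm_nonneg (r τ))
      have h2 : γ / hi * V τ ≤ γ * z τ := by
        rw [div_mul_eq_mul_div, div_le_iff₀ hhi]
        nlinarith [(hbounds τ (hsub hmem)).2]
      simp only [hV, hz] at h2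
      linarith)
  rw [zero_div, zero_add, sub_zero] at hdecay
  have h1 : z t ≤ hi / lo * Real.exp (-(γ / hi) * (t - t₀)) * z t₀ := by
    have h2 : lo * z t ≤ Real.exp (-(γ / hi) * (t - t₀)) * (hi * z t₀) :=
      (hbounds t ht).1.trans (hdecay.trans
        (mul_le_mul_of_nonneg_left (hbounds t₀ ht₀).2 (Real.exp_pos _).le))
    calc z t ≤ Real.exp (-(γ / hi) * (t - t₀)) * (hi * z t₀) / lo := by
          rwa [le_div_iff₀ hlo, mul_comm]
      _ = _ := by ring
  have h3 : Real.exp (-(γ / hi) * (t - t₀)) = Real.exp (-(γ / (2 * hi)) * (t - t₀)) ^ 2 := by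
    rw [← Real.exp_nat_mul]
    congr 1
    push_cast
    field_simp
  calc √(z t) ≤ √(hi / lo * Real.exp (-(γ / hi) * (t - t₀)) * z t₀) := Real.sqrt_le_sqrt h1
    _ = _ := by
      rw [h3, Real.sqrt_mul (by positivity), Real.sqrt_mul (by positivity),
        Real.sqrt_sq (Real.exp_pos _).le]

end IsErrorSystem

/-! ### From the observer to the error system -/

theorem abs_entry_mul_skew_le {R : Mat3} (hR : R ∈ SO3) (x : Vec3) (i j : Fin 3) :
    ‖(R * skew x) i j‖ ≤ ‖x‖ := by
  have h : (R * skew x) i j = act (R * skew x) (EuclideanSpace.single j 1) i := by simp [act]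
  rw [h]
  refine (PiLp.norm_apply_le _ i).trans ?_
  rw [act_mul, act_skew, norm_act hR]
  simpa using norm_cross_le x (EuclideanSpace.single j 1)

section Derivation

variable {q : ObserverParams} {P : RigidBody} {X : ObserverState} {Proj : Vec3 → Vec3 → Vec3}
  {t₀ T l c₁ c₂ c₃ c₄ c₅ : ℝ}

theorem act_rotation_accel {t : ℝ} (hR : P.R t ∈ SO3) : act (P.R t)ᵀ (P.ra t) = P.ba t :=
  act_transpose_act hR _

theorem act_rotation_innovation {t : ℝ} (hR : P.R t ∈ SO3) :
    act (P.R t) (X.σR q P t) =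
      perturbedInnovation q.ρ₁ q.ρ₂ q.rm (P.ra t) (X.erra q P t) (X.errR P t) := by
  have e : X.rah q P t = P.ra t - X.erra q P t := by simp [ObserverState.erra]
  rw [ObserverState.σR, act_add, act_smul, act_smul, act_cross hR, act_cross hR, RigidBody.bm,
    act_act_transpose hR, ← act_mul, ← act_mul, e, act_sub, cross_sub_right]
  change q.ρ₁ • cross q.rm (act (X.errR P t) q.rm) + q.ρ₂ • (cross (P.ra t) (act (X.errR P t)
    (P.ra t)) - cross (P.ra t) (act (X.errR P t) (X.erra q P t))) = _
  rw [perturbedInnovation, innovation]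
  module

theorem absolutelyContinuousOnInterval_rotation {g : ℝ} (hP : P.IsMotion g)
    (hω : P.BoundedGyro c₄ c₅) (h0 : 0 ≤ t₀) (hT : t₀ ≤ T) (i j : Fin 3) :
    AbsolutelyContinuousOnInterval (fun t => P.R t i j) t₀ T :=
  absolutelyContinuousOnInterval_of_hasDerivWithinAt hT
    (fun _ ht => h0.trans ht.1) (fun t ht => hP.R_ode t (h0.trans ht.1) i j)
    (fun t ht => (abs_entry_mul_skew_le (hP.mem_SO3 t (h0.trans ht.1)) _ i j).trans
      (hω.1 t (h0.trans ht.1)))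

theorem absolutelyContinuousOnInterval_accel (ha : P.BoundedAccel c₁ c₂ c₃)
    (h0 : 0 ≤ t₀) (hT : t₀ ≤ T) : AbsolutelyContinuousOnInterval P.ra t₀ T := by
  obtain ⟨ra', hra⟩ := ha.2
  exact absolutelyContinuousOnInterval_of_hasDerivWithinAt hT (fun _ ht => h0.trans ht.1)
    (fun t ht => (hra t (h0.trans ht.1)).1) (fun t ht => (hra t (h0.trans ht.1)).2)

theorem absolutelyContinuousOnInterval_bodyAccel {g : ℝ} (hP : P.IsMotion g)
    (ha : P.BoundedAccel c₁ c₂ c₃) (hω : P.BoundedGyro c₄ c₅) (h0 : 0 ≤ t₀) (hT : t₀ ≤ T) :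
    AbsolutelyContinuousOnInterval P.ba t₀ T :=
  (AbsolutelyContinuousOnInterval.act (M := fun t => (P.R t)ᵀ)
    (fun i j => absolutelyContinuousOnInterval_rotation hP hω h0 hT j i)
    (absolutelyContinuousOnInterval_accel ha h0 hT)).congr hT
    fun t ht => act_rotation_accel (hP.mem_SO3 t (h0.trans ht.1))

theorem absolutelyContinuousOnInterval_velocity {g : ℝ} (hP : P.IsMotion g)
    (ha : P.BoundedAccel c₁ c₂ c₃) (h0 : 0 ≤ t₀) (hT : t₀ ≤ T) :
    AbsolutelyContinuousOnInterval P.v t₀ T :=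
  absolutelyContinuousOnInterval_of_hasDerivWithinAt hT (fun _ ht => h0.trans ht.1)
    (fun t ht => hP.v_ode t (h0.trans ht.1))
    (fun t ht => (norm_add_le _ _).trans (add_le_add_right (ha.1 t (h0.trans ht.1)).2 _))

theorem absolutelyContinuousOnInterval_rah {g : ℝ} (hP : P.IsMotion g)
    (ha : P.BoundedAccel c₁ c₂ c₃) (hω : P.BoundedGyro c₄ c₅) (h0 : 0 ≤ t₀) (hT : t₀ ≤ T)
    (hX : X.IsSolution q P Proj t₀ T) :
    AbsolutelyContinuousOnInterval (X.rah q P) t₀ T :=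
  (((absolutelyContinuousOnInterval_velocity hP ha h0 hT).fun_sub hX.vh_ac).const_smul
    q.kv).fun_add (.act hX.Rh_ac (absolutelyContinuousOnInterval_bodyAccel hP ha hω h0 hT))

theorem absolutelyContinuousOnInterval_σR {g : ℝ} (hP : P.IsMotion g)
    (ha : P.BoundedAccel c₁ c₂ c₃) (hω : P.BoundedGyro c₄ c₅) (h0 : 0 ≤ t₀) (hT : t₀ ≤ T)
    (hX : X.IsSolution q P Proj t₀ T) :
    AbsolutelyContinuousOnInterval (X.σR q P) t₀ T := by
  have hrm := absolutelyContinuousOnInterval_const (a := t₀) (b := T) q.rm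
  have hRT := AbsolutelyContinuousOnInterval.act (M := fun t => (P.R t)ᵀ)
    (fun i j => absolutelyContinuousOnInterval_rotation hP hω h0 hT j i) hrm
  have hRh {f : ℝ → Vec3} (hf : AbsolutelyContinuousOnInterval f t₀ T) :=
    AbsolutelyContinuousOnInterval.act (M := fun t => (X.Rh t)ᵀ) (fun i j => hX.Rh_ac j i) hf
  exact ((hRT.cross (hRh hrm)).const_smul q.ρ₁).fun_add
    (((absolutelyContinuousOnInterval_bodyAccel hP ha hω h0 hT).cross
      (hRh (absolutelyContinuousOnInterval_rah hP ha hω h0 hT hX))).const_smul q.ρ₂)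

theorem norm_bias_estimate_le {g : ℝ} (hP : P.IsMotion g)
    (ha : P.BoundedAccel c₁ c₂ c₃) (hω : P.BoundedGyro c₄ c₅) (h0 : 0 ≤ t₀) (hT : t₀ ≤ T)
    (hProj : IsParamProjection Proj c₅ P.bω) (hX : X.IsSolution q P Proj t₀ T)
    (hb : ‖X.bh t₀‖ ≤ c₅) : ∀ t ∈ Icc t₀ T, ‖X.bh t‖ ≤ c₅ := by
  refine hProj.bounded t₀ T _ X.bh hT ?_ hX.bh_ac hX.bh_ode hb
  have h := ((absolutelyContinuousOnInterval_σR hP ha hω h0 hT hX).const_smul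
    q.kb).fun_neg.continuousOn
  rwa [uIcc_of_le hT] at h

theorem errR_rate {t : ℝ} {Ω : Vec3} (hR : P.R t ∈ SO3) :
    P.R t * skew (P.ω t) * (X.Rh t)ᵀ + P.R t * (X.Rh t * skew (P.ω t + Ω))ᵀ =
      -(skew (act (P.R t) Ω) * X.errR P t) := by
  refine mat3_ext_act fun w => ?_
  rw [Matrix.transpose_mul, skew_transpose, ObserverState.errR]
  simp only [add_act, neg_act, act_mul, act_skew, act_neg, cross_add_left, act_add, act_cross hR]
  abel

theorem erra_rate {t : ℝ} {a' : Vec3} (hR : P.R t ∈ SO3) (hkv : q.kv ≠ 0) :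
    a' - (q.kv • (q.g • e3 + act (P.R t) (P.ba t) -
        (q.g • e3 + act (X.Rh t) (P.ba t) + q.kv • X.σv q P t)) +
      (act (X.Rh t * skew (P.ωy t - X.bh t + q.kR • X.σR q P t)) (P.ba t) +
        act (X.Rh t) (act (P.R t * skew (P.ω t))ᵀ (P.ra t) + act (P.R t)ᵀ a'))) =
      -q.kv • X.erra q P t + (a' - act (X.errR P t)ᵀ a') -
        act (X.errR P t)ᵀ (cross (act (P.R t) (X.errb P t)) (P.ra t)) := by
  have e1 : act (P.R t * skew (P.ω t))ᵀ (P.ra t) = -cross (P.ω t) (P.ba t) := by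
    rw [Matrix.transpose_mul, act_mul, act_rotation_accel hR, skew_transpose, neg_act, act_skew]
  have e2 (w : Vec3) : act (X.errR P t)ᵀ w = act (X.Rh t) (act (P.R t)ᵀ w) := by
    rw [ObserverState.errR, Matrix.transpose_mul, Matrix.transpose_transpose, act_mul]
  have e3 : act (P.R t)ᵀ (cross (act (P.R t) (X.errb P t)) (P.ra t)) =
      cross (P.bω - X.bh t) (P.ba t) := by
    rw [act_cross (transpose_mem_SO3 hR), act_transpose_act hR, act_rotation_accel hR,
      ObserverState.errb]
  rw [e2, e2, e3, e1]
  simp only [ObserverState.σv, ObserverState.erra, ObserverState.rah, RigidBody.ra,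
    RigidBody.ωy, act_mul, act_skew, cross_add_left, cross_sub_left, cross_smul_left, act_add,
    act_sub, act_neg, act_smul]
  match_scalars <;> field_simp <;> ring

/-- The observer errors satisfy the error system. The term with `k_R / k_v²` in `σ_v` is what makes
the attitude gain disappear from the acceleration error dynamics. -/
theorem isErrorSystem_of_isSolution (hP : P.IsMotion q.g) (hkv : q.kv ≠ 0) (hkb : 0 ≤ q.kb)
    (ha : P.BoundedAccel c₁ c₂ c₃) (hω : P.BoundedGyro c₄ c₅)
    (hl : ∀ t, 0 ≤ t → IsCoercivePair q.ρ₁ q.ρ₂ l q.rm (P.ra t)) (h0 : 0 ≤ t₀) (hT : t₀ ≤ T)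
    (hProj : IsParamProjection Proj c₅ P.bω) (hX : X.IsSolution q P Proj t₀ T)
    (hb : ‖X.bh t₀‖ ≤ c₅) :
    IsErrorSystem q l c₂ c₃ c₄ c₅ t₀ T (X.errR P) (fun t => act (P.R t) (X.errb P t))
      (X.erra q P) P.ra where
  mem_SO3 t ht :=
    Submonoid.mul_mem (Matrix.specialOrthogonalGroup (Fin 3) ℝ)
      (hP.mem_SO3 t (h0.trans ht.1)) (transpose_mem_SO3 (hX.mem_SO3 t ht))
  norm_bias_le t ht := by
    rw [norm_act (hP.mem_SO3 t (h0.trans ht.1)), ObserverState.errb]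
    linarith [norm_sub_le P.bω (X.bh t), hω.2,
      norm_bias_estimate_le hP ha hω h0 hT hProj hX hb t ht]
  norm_accel_le t ht := (ha.1 t (h0.trans ht.1)).2
  coercive t ht := hl t (h0.trans ht.1)
  ac_att := .mat3_mul (absolutelyContinuousOnInterval_rotation hP hω h0 hT)
    (N := fun t => (X.Rh t)ᵀ) fun i j => hX.Rh_ac j i
  ac_bias := .act (absolutelyContinuousOnInterval_rotation hP hω h0 hT)
    ((absolutelyContinuousOnInterval_const _).fun_sub hX.bh_ac)
  ac_err := (absolutelyContinuousOnInterval_accel ha h0 hT).fun_sub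
    (absolutelyContinuousOnInterval_rah hP ha hω h0 hT hX)
  ac_accel := absolutelyContinuousOnInterval_accel ha h0 hT
  ode := by
    obtain ⟨ra', hra'⟩ := ha.2
    have hne : ∀ᵐ t ∂(volume : Measure ℝ), t ≠ 0 := by simp [ae_iff, measure_singleton]
    filter_upwards [hX.vh_ode, hX.Rh_ode, hX.bh_ode, hne] with t hvh hRh hbh ht0 ht
    have hpos : 0 < t := lt_of_le_of_ne (h0.trans ht.1) (Ne.symm ht0)
    have hnhds : Ici (0 : ℝ) ∈ nhds t := Ici_mem_nhds hpos
    have hR := hP.mem_SO3 t hpos.le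
    have dR i j := (hP.R_ode t hpos.le i j).hasDerivAt hnhds
    have dRh := hRh ht
    have da := (hra' t hpos.le).1.hasDerivAt hnhds
    have dba : HasDerivAt P.ba
        (act (P.R t * skew (P.ω t))ᵀ (P.ra t) + act (P.R t)ᵀ (ra' t)) t := by
      refine (HasDerivAt.act (M := fun s => (P.R s)ᵀ) (fun i j => dR j i) da).congr_of_eventuallyEq
        ?_
      filter_upwards [hnhds] with s hs using (act_rotation_accel (hP.mem_SO3 s hs)).symm
    have hbt := norm_bias_estimate_le hP ha hω h0 hT hProj hX hb t ht
    refine ⟨act (P.R t) (X.σR q P t), act (P.R t) (P.ω t),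
      act (P.R t) (-Proj (X.bh t) (-(q.kb • X.σR q P t))), ra' t,
      act_rotation_innovation hR, ?_, ?_, ?_, (hra' t hpos.le).2, fun i j => ?_, ?_, ?_, da⟩
    · rw [norm_act hR]; exact hω.1 t hpos.le
    · rw [norm_act hR, norm_act hR, norm_neg]
      refine (hProj.norm_le _ _ hbt).trans_eq ?_
      rw [norm_neg, norm_smul, Real.norm_of_nonneg hkb]
    · rw [inner_act_act hR, inner_act_act hR]
      have h := hProj.inner_le (X.bh t) (-(q.kb • X.σR q P t)) hbt
      have e : X.errb P t = -(X.bh t - P.bω) := by simp [ObserverState.errb]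
      rw [e, inner_neg_left, inner_neg_right, neg_neg]
      rw [inner_neg_right, inner_smul_right] at h
      rw [inner_neg_left]
      linarith
    · refine (HasDerivAt.mat3_mul dR (N := fun s => (X.Rh s)ᵀ) (fun i j => dRh j i)
        i j).congr_deriv ?_
      have e : P.ωy t - X.bh t + q.kR • X.σR q P t =
          P.ω t + (X.errb P t + q.kR • X.σR q P t) := by
        simp only [RigidBody.ωy, ObserverState.errb]; abel
      have h := errR_rate (X := X) (Ω := X.errb P t + q.kR • X.σR q P t) hR
      rw [← e, act_add, act_smul] at h
      exact congrFun (congrFun h i) j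
    · refine (HasDerivAt.act dR ((hbh ht).const_sub P.bω)).congr_deriv ?_
      rw [act_mul, act_skew, act_cross hR]
      rfl
    · refine (da.sub (((((hP.v_ode t hpos.le).hasDerivAt hnhds).sub (hvh ht)).const_smul
        q.kv).add (HasDerivAt.act dRh dba))).congr_deriv ?_
      exact erra_rate hR hkv

end Derivation

/-! ### Choice of the gains -/

theorem mul_mul_le_add_sq {A : ℝ} (hA : 0 < A) (G x y : ℝ) :
    G * x * y ≤ A * x ^ 2 + G ^ 2 / (4 * A) * y ^ 2 := by
  have h : A * x ^ 2 + G ^ 2 / (4 * A) * y ^ 2 - G * x * y = (2 * A * x - G * y) ^ 2 / (4 * A) := by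
    field_simp; ring
  have : 0 ≤ (2 * A * x - G * y) ^ 2 / (4 * A) := by positivity
  linarith

/-- With the weight `κ / kR` for the cross term, the attitude gain makes the rate bound negative
definite in the attitude and bias errors, and then the velocity gain makes it negative definite
in all errors. With this weight the coupling coefficient of the attitude and bias errors is of
order `κ`, uniformly in `kR`, and the product of their damping rates is of order
`kR · (κ / kR) = κ`, which exceeds the square of the coupling coefficient when `κ` is small. -/
theorem rateBound_le {q : ObserverParams} {l M c₂ c₃ c₄ c₅ u κ μ : ℝ}
    (hμ : μ = 2 * (1 - u) * l ^ 2) (hμ0 : 0 < μ) (hkb : 0 ≤ q.kb)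
    (hM : 0 ≤ M) (hc₄ : 0 ≤ c₄) (hc₅ : 0 ≤ c₅)
    (hκ : 0 < κ) (hκ1 : κ ≤ 1) (hκn : κ * (6 * c₅ + 2 * c₄ + 8 * M) ^ 2 ≤ μ / 4)
    (hkR : 1 ≤ q.kR) (hkR' : 2 * q.ρ₂ * c₂ * c₃ + 4 * q.kb * M ≤ q.kR * μ / 4)
    (hkv : (q.kR * q.ρ₂ * c₂ * M + κ / q.kR * (2 * q.kb * q.ρ₂ * c₂) + 4 * c₃) ^ 2 / (q.kR * μ) +
      (q.ρ₂ * c₂ / 2 + κ / q.kR * (4 * q.kR * q.ρ₂ * c₂) + 2 * c₂) ^ 2 / (κ / q.kR) ≤ q.kv)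
    {y b : ℝ} (hy : 0 ≤ y) (hb : 0 ≤ b) (r : ℝ) :
    rateBound q l M c₂ c₃ c₄ c₅ u (κ / q.kR) y b r ≤
      -(q.kR * μ / 4 * y ^ 2 + κ / q.kR / 2 * b ^ 2 + q.kv * r ^ 2) := by
  have hkR0 : 0 < q.kR := one_pos.trans_le hkR
  set δ := κ / q.kR with hδ
  have hδ0 : 0 < δ := by positivity
  have hδκ : δ * q.kR = κ := by rw [hδ]; field_simp
  have hδle : δ ≤ κ := div_le_self hκ.le hkR
  set Gy := q.kR * q.ρ₂ * c₂ * M + δ * (2 * q.kb * q.ρ₂ * c₂) + 4 * c₃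
  set Gb := q.ρ₂ * c₂ / 2 + δ * (4 * q.kR * q.ρ₂ * c₂) + 2 * c₂
  set n := 6 * c₅ + 2 * c₄ + 8 * M with hn
  have hA : 0 < q.kR * μ / 4 := by positivity
  have t1 : (2 * q.ρ₂ * c₂ * c₃ + δ * (4 * q.kb * M)) * y ^ 2 ≤ q.kR * μ / 4 * y ^ 2 := by
    refine mul_le_mul_of_nonneg_right (le_trans ?_ hkR') (sq_nonneg y)
    have := mul_le_of_le_one_left (by positivity : 0 ≤ 4 * q.kb * M) (hδle.trans hκ1)
    linarith
  have t2 : δ * (6 * c₅ + 2 * c₄ + 8 * q.kR * M) * y * b ≤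
      q.kR * μ / 4 * y ^ 2 + δ / 4 * b ^ 2 := by
    have e : δ * (6 * c₅ + 2 * c₄ + 8 * q.kR * M) ≤ κ * n := by
      have := mul_le_mul_of_nonneg_right hδle (by positivity : 0 ≤ 6 * c₅ + 2 * c₄)
      have e2 : δ * (8 * q.kR * M) = κ * (8 * M) := by rw [← hδκ]; ring
      rw [mul_add, e2, hn]
      linarith
    have e3 : (κ * n) ^ 2 / (4 * (q.kR * μ / 4)) ≤ δ / 4 := by
      rw [div_le_div_iff₀ (by positivity) (by norm_num), ← hδκ]
      have := mul_le_mul_of_nonneg_left hκn (by positivity : 0 ≤ κ)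
      rw [← hδκ] at this
      nlinarith
    calc δ * (6 * c₅ + 2 * c₄ + 8 * q.kR * M) * y * b ≤ κ * n * y * b := by gcongr
      _ ≤ _ := mul_mul_le_add_sq hA _ _ _
      _ ≤ _ := by gcongr
  have t3 := mul_mul_le_add_sq hA Gy y r
  have t4 := mul_mul_le_add_sq (by positivity : 0 < δ / 4) Gb b r
  have t5 := mul_le_mul_of_nonneg_right hkv (sq_nonneg r)
  have e3 : 4 * (q.kR * μ / 4) = q.kR * μ := by ring
  have e4 : 4 * (δ / 4) = δ := by ring
  rw [e3] at t3
  rw [e4] at t4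
  have key : rateBound q l M c₂ c₃ c₄ c₅ u δ y b r =
      -(q.kR * μ) * y ^ 2 + (2 * q.ρ₂ * c₂ * c₃ + δ * (4 * q.kb * M)) * y ^ 2 +
        δ * (6 * c₅ + 2 * c₄ + 8 * q.kR * M) * y * b - δ * b ^ 2 + Gy * y * r + Gb * b * r -
        2 * q.kv * r ^ 2 := by
    rw [rateBound, hμ]; ring
  rw [key]
  linarith

end

theorem theorem1
    (g ρ₁ ρ₂ kb : ℝ) (rm : Vec3) (hρ₁ : 0 < ρ₁) (hρ₂ : 0 < ρ₂) (hkb : 0 < kb)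
    (c₀ c₁ c₂ c₃ c₄ c₅ : ℝ) (hc₀ : 0 < c₀) (hc₁ : 0 < c₁) (hc₂ : 0 < c₂)
    (hc₃ : 0 < c₃) (hc₄ : 0 < c₄) (hc₅ : 0 < c₅)
    (εR : ℝ) (hεR₀ : 0 < εR) (hεR₁ : εR < 1) (B : ℝ) (hB : 0 ≤ B) :
    ∃ kRlow : ℝ, 0 < kRlow ∧ ∀ kR : ℝ, kRlow ≤ kR →
    ∃ kvlow : ℝ, 0 < kvlow ∧ ∀ kv : ℝ, kvlow < kv →
    ∃ C α : ℝ, 0 < C ∧ 0 < α ∧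
      ∀ q : ObserverParams, q = ⟨g, rm, ρ₁, ρ₂, kb, kR, kv⟩ →
      ∀ P : RigidBody, P.IsMotion g → P.Observable rm c₀ → P.BoundedAccel c₁ c₂ c₃ →
        P.BoundedGyro c₄ c₅ →
      ∀ Proj : Vec3 → Vec3 → Vec3, IsParamProjection Proj c₅ P.bω →
      ∀ t₀ T : ℝ, 0 ≤ t₀ → t₀ ≤ T →
      ∀ X : ObserverState, X.IsSolution q P Proj t₀ T →
        attNorm (X.errR P t₀) ≤ εR → ‖X.erra q P t₀‖ ≤ B → ‖X.bh t₀‖ ≤ c₅ →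
        ∀ t ∈ Icc t₀ T,
          X.errDist q P t ≤ C * Real.exp (-α * (t - t₀)) * X.errDist q P t₀ := by
  obtain ⟨l, hl⟩ : ∃ l, l = c₀ ^ 2 / (3 / (ρ₁ * ‖rm‖ ^ 2) + 2 / (ρ₂ * c₁ ^ 2)) := ⟨_, rfl⟩
  have hl0 : 0 < l := by rw [hl]; positivity
  -- The level of `|R̃|_I²` that is never crossed, halfway between `εR²` and `1`.
  obtain ⟨u, hu⟩ : ∃ u, u = (1 + εR ^ 2) / 2 := ⟨_, rfl⟩
  have hεR2 : εR ^ 2 < 1 := pow_lt_one₀ hεR₀.le hεR₁ two_ne_zero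
  have hu0 : 0 < u := by rw [hu]; positivity
  have hu1 : u < 1 := by linarith
  have h1u : 0 < 1 - u := by linarith
  have hεu : 0 < u - εR ^ 2 := by linarith
  obtain ⟨M, hM⟩ : ∃ M, M = ρ₁ * ‖rm‖ ^ 2 + ρ₂ * c₂ ^ 2 := ⟨_, rfl⟩
  have hM0 : 0 < M := by rw [hM]; positivity
  obtain ⟨μ, hμ⟩ : ∃ μ, μ = 2 * (1 - u) * l ^ 2 := ⟨_, rfl⟩
  have hμ0 : 0 < μ := by rw [hμ]; positivity
  obtain ⟨n, hn⟩ : ∃ n, n = 6 * c₅ + 2 * c₄ + 8 * M := ⟨_, rfl⟩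
  have hn0 : 0 < n := by rw [hn]; positivity
  obtain ⟨κ, hκ⟩ : ∃ κ, κ = min 1 (μ / (4 * n ^ 2)) := ⟨_, rfl⟩
  have hκ0 : 0 < κ := by rw [hκ]; positivity
  have hκ1 : κ ≤ 1 := hκ ▸ min_le_left _ _
  have hκn : κ * n ^ 2 ≤ μ / 4 := by
    calc κ * n ^ 2 ≤ μ / (4 * n ^ 2) * n ^ 2 := by
          gcongr; exact hκ ▸ min_le_right _ _
      _ = μ / 4 := by field_simp
  obtain ⟨k₁, hk₁⟩ : ∃ k, k = 4 * (2 * ρ₂ * c₂ * c₃ + 4 * kb * M) / μ := ⟨_, rfl⟩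
  obtain ⟨k₂, hk₂⟩ : ∃ k, k = 16 * kb / l := ⟨_, rfl⟩
  obtain ⟨k₃, hk₃⟩ : ∃ k, k = (c₅ + 1) / (l * (1 - u) * u) := ⟨_, rfl⟩
  have hk₁0 : 0 < k₁ := by rw [hk₁]; positivity
  have hk₂0 : 0 < k₂ := by rw [hk₂]; positivity
  have hk₃0 : 0 < k₃ := by rw [hk₃]; positivity
  refine ⟨1 + k₁ + k₂ + k₃, by positivity, fun kR hkR => ?_⟩
  have hkR1 : 1 ≤ kR := by linarith
  have hkR0 : 0 < kR := by linarith
  have hkR₁ : 2 * ρ₂ * c₂ * c₃ + 4 * kb * M ≤ kR * μ / 4 := by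
    have : k₁ ≤ kR := by linarith
    rw [hk₁, div_le_iff₀ hμ0] at this
    linarith
  have hkR₂ : 16 * kb ≤ kR * l := by
    have : k₂ ≤ kR := by linarith
    rwa [hk₂, div_le_iff₀ hl0] at this
  obtain ⟨κ₁, hκ₁⟩ : ∃ κ, κ = 2 * kR * l * (1 - u) := ⟨_, rfl⟩
  have hκ₁0 : 0 < κ₁ := by rw [hκ₁]; positivity
  have hD : (c₅ + 1) / κ₁ < u := by
    have : k₃ ≤ kR := by linarith
    rw [hk₃, div_le_iff₀ (by positivity)] at this
    rw [div_lt_iff₀ hκ₁0, hκ₁]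
    linarith
  obtain ⟨δ, hδ⟩ : ∃ δ, δ = κ / kR := ⟨_, rfl⟩
  have hδ0 : 0 < δ := by rw [hδ]; positivity
  have hδ2 : δ ^ 2 ≤ l / (16 * kb) := by
    have h1 : δ ≤ 1 / kR := by rw [hδ]; gcongr
    have h2 : 1 / kR ≤ l / (16 * kb) := by
      rw [div_le_div_iff₀ hkR0 (by positivity)]; linarith
    have h3 : 1 / kR ≤ 1 := by rw [div_le_one hkR0]; exact hkR1
    exact (pow_le_of_le_one hδ0.le (h1.trans h3) two_ne_zero).trans (h1.trans h2)
  -- The weight of the acceleration error in the invariant set is small compared with `B`.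
  obtain ⟨p, hp⟩ : ∃ p, p = (u - εR ^ 2) / (2 * (B ^ 2 + 1)) := ⟨_, rfl⟩
  have hp0 : 0 < p := by rw [hp]; positivity
  have hpB : p * B ^ 2 < u - εR ^ 2 := by
    have : p * (B ^ 2 + 1) = (u - εR ^ 2) / 2 := by rw [hp]; field_simp
    linarith
  obtain ⟨G, hG⟩ : ∃ G, G = (kR * ρ₂ * c₂ / 2 + 2 * p * (2 * c₃ + 2 * c₅ * c₂)) ^ 2 / p :=
    ⟨_, rfl⟩
  obtain ⟨H, hH⟩ : ∃ H, H =
      (kR * ρ₂ * c₂ * M + κ / kR * (2 * kb * ρ₂ * c₂) + 4 * c₃) ^ 2 / (kR * μ) +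
      (ρ₂ * c₂ / 2 + κ / kR * (4 * kR * ρ₂ * c₂) + 2 * c₂) ^ 2 / (κ / kR) := ⟨_, rfl⟩
  have hG0 : 0 < G := by rw [hG]; positivity
  have hH0 : 0 < H := by rw [hH]; positivity
  refine ⟨κ₁ + G + H, by positivity, fun kv hkv => ?_⟩
  have hkv0 : 0 < kv := by linarith
  obtain ⟨γ, hγ⟩ : ∃ γ, γ = min (kR * μ / 4) (min (δ / 2) kv) := ⟨_, rfl⟩
  have hγ0 : 0 < γ := by rw [hγ]; positivity
  have hγ₁ : γ ≤ kR * μ / 4 := hγ ▸ min_le_left _ _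
  have hγ₂ : γ ≤ δ / 2 := hγ ▸ (min_le_right _ _).trans (min_le_left _ _)
  have hγ₃ : γ ≤ kv := hγ ▸ (min_le_right _ _).trans (min_le_right _ _)
  obtain ⟨lo, hlo⟩ : ∃ lo, lo = min (l / 2) (min (1 / (8 * kb)) 1) := ⟨_, rfl⟩
  have hlo0 : 0 < lo := by rw [hlo]; positivity
  have hlo₁ : lo ≤ l / 2 := hlo ▸ min_le_left _ _
  have hlo₂ : lo ≤ 1 / (8 * kb) := hlo ▸ (min_le_right _ _).trans (min_le_left _ _)
  have hlo₃ : lo ≤ 1 := hlo ▸ (min_le_right _ _).trans (min_le_right _ _)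
  have hkb4 : 0 < 1 / (4 * kb) := by positivity
  obtain ⟨hi, hhi⟩ : ∃ hi, hi = M + 1 / (4 * kb) + δ + 1 := ⟨_, rfl⟩
  have hhi0 : 0 < hi := by rw [hhi]; positivity
  refine ⟨√(hi / lo), γ / (2 * hi), by positivity, by positivity, ?_⟩
  rintro q rfl P hP hobs ha hω Proj hProj t₀ T h0 hT X hX hR₀ hr₀ hb₀
  have S := isErrorSystem_of_isSolution hP hkv0.ne' hkb.le ha hω
    (fun t ht => hl ▸ isCoercivePair_of_observable hρ₁ hρ₂ hc₀ hc₁ (ha.1 t ht).1 (hobs t ht))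
    h0 hT hProj hX hb₀
  have hy := S.attNorm_sq_le hρ₂.le hkR0.le hc₂.le hc₃.le hl0.le hp0 hκ₁0 hu1 hκ₁.le (by
    rw [hG] at hkv hG0
    have : (kR * ρ₂ * c₂ / 2 + 2 * p * (2 * c₃ + 2 * c₅ * c₂)) ^ 2 / p ≤ 2 * kv - κ₁ := by
      linarith
    rw [div_le_iff₀ hp0] at this
    rw [mul_comm p]
    exact this) hD (by
    have h1 := pow_le_pow_left₀ (attNorm_nonneg _) hR₀ 2
    have h2 := mul_le_mul_of_nonneg_left (pow_le_pow_left₀ (norm_nonneg _) hr₀ 2) hp0.le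
    linarith)
  intro t ht
  have main := S.errDist_le hρ₁.le hρ₂.le hkb hkR0.le hl0.le hc₂.le hM.ge hu1 hδ0.le hδ2 hγ0
    hlo0 hhi0 hlo₁ hlo₂ hlo₃ (by linarith) (by linarith) (by rw [hhi]; linarith) (by
      intro y b r hy hb _
      have h := rateBound_le (q := ⟨g, rm, ρ₁, ρ₂, kb, kR, kv⟩) hμ hμ0 hkb.le hM0.le
        hc₄.le hc₅.le hκ0 hκ1 (hn ▸ hκn) hkR1 hkR₁
        (c₂ := c₂) (c₃ := c₃) (hH ▸ by linarith) hy hb r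
      rw [← hδ] at h
      refine h.trans ?_
      have k1 := mul_le_mul_of_nonneg_right hγ₁ (sq_nonneg y)
      have k2 := mul_le_mul_of_nonneg_right hγ₂ (sq_nonneg b)
      have k3 := mul_le_mul_of_nonneg_right hγ₃ (sq_nonneg r)
      simp only
      linarith) hy t ht
  have e (s) (hs : s ∈ Icc t₀ T) : ‖act (P.R s) (X.errb P s)‖ = ‖X.errb P s‖ :=
    norm_act (hP.mem_SO3 s (h0.trans hs.1)) _
  rw [e t ht, e t₀ (left_mem_Icc.2 hT)] at main
  exact main
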